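/- Let $d\ge 1$, $R>0$, $T\ge 0$, and let $B_T:=\{x\in\mathbb R^d : |x|<R+T\}$. All function spaces are real. Write $\|\cdot\|$ for the norm of $L^2(B_T)$ and of $L^2(B_T)^d$, so that $\|\nabla v\|^2=\sum_{i=1}^d\|\partial_i v\|^2$. As usual, $H^1_0(B_T)$ is the closure of $C_c^\infty(B_T)$ in $H^1(B_T)$. There exist constants $C_T$ with the Poincaré–Friedrichs property $$\|v\|\le C_T\,\|\nabla v\|\qquad\text{for all } v\in H^1_0(B_T).$$ Let $f:[0,\infty)\to H^1_0(B_T)$ be continuous. Then there is a unique strong solution $u$ of the Dirichlet problem for the wave equation $$\ddot u(t)=\Delta u(t)+f(t)\quad (t\ge 0),\qquad u(t)=0 \text{ on }\partial B_T\quad (t\ge0),\qquad u(0)=\dot u(0)=0,$$ that is, a unique function $$u\in C^2([0,\infty);L^2(B_T))\cap C^1([0,\infty);H^1_0(B_T))\cap C([0,\infty);H^2(B_T))$$ with $u(0)=\dot u(0)=0$ for which the differential equation holds in $L^2(B_T)$ for every $t\ge 0$ (time derivatives at $t=0$ are right derivatives). Moreover, for every $t\ge 0$ and every constant $C_T$ with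 the property above, $$\|u(t)\|\le C_T\int_0^t\|f(\tau)\|\,d\tau,\qquad \|\nabla u(t)\|\le\int_0^t\|f(\tau)\|\,d\tau,\qquad \|\Delta u(t)\|\le\int_0^t\|\nabla f(\tau)\|\,d\tau .$$ -/

import Mathlib

open MeasureTheory TopologicalSpace Set
open scoped Distributions

noncomputable section

namespace DirichletWave

/-- The Euclidean space `ℝ^d`. -/
abbrev Euc (d : ℕ) : Type := EuclideanSpace ℝ (Fin d)

/-- The open ball of radius `r` centred at the origin, as a bundled open set. -/
def originBall (d : ℕ) (r : ℝ) : Opens (Euc d) := ⟨Metric.ball 0 r, Metric.isOpen_ball⟩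

/-- The real Hilbert space `L²(Ω)`. -/
abbrev L2 {d : ℕ} (Ω : Opens (Euc d)) : Type :=
  Lp ℝ 2 ((volume : Measure (Euc d)).restrict (Ω : Set (Euc d)))

/-- `L²(Ω)^ι` with its Hilbert norm: `‖g‖² = ∑ i, ‖g i‖²`. -/
abbrev L2Pow {d : ℕ} (ι : Type) [Fintype ι] (Ω : Opens (Euc d)) : Type :=
  PiLp 2 (fun _ : ι => L2 Ω)

/-- The classical partial derivative `∂ᵢ φ`. -/
def partialDeriv {d : ℕ} (i : Fin d) (φ : Euc d → ℝ) (x : Euc d) : ℝ :=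
  fderiv ℝ φ x (EuclideanSpace.single i 1)

/-- `g = ∂ᵢ u` in the weak sense on `Ω`; the test functions are smooth with compact support
contained in `Ω`. -/
def IsWeakPartial {d : ℕ} (Ω : Opens (Euc d)) (i : Fin d) (u g : L2 Ω) : Prop :=
  ∀ φ : 𝓓(Ω, ℝ), ∫ x in (Ω : Set (Euc d)), u x * partialDeriv i φ x
    = -∫ x in (Ω : Set (Euc d)), g x * φ x

section linearity

variable {d : ℕ} {Ω : Opens (Euc d)} {i : Fin d}

theorem integrable_mul_test (u : L2 Ω) {ψ : Euc d → ℝ} (hc : Continuous ψ)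
    (hs : HasCompactSupport ψ) :
    Integrable (fun x => u x * ψ x)
      ((volume : Measure (Euc d)).restrict (Ω : Set (Euc d))) :=
  MemLp.integrable_mul (p := 2) (q := 2) (Lp.memLp u) (hc.memLp_of_hasCompactSupport hs)

theorem integrable_mul_partialDeriv (u : L2 Ω) (φ : 𝓓(Ω, ℝ)) :
    Integrable (fun x => u x * partialDeriv i φ x)
      ((volume : Measure (Euc d)).restrict (Ω : Set (Euc d))) := by
  refine integrable_mul_test u ?_ ?_
  · exact (φ.contDiff.continuous_fderiv (by simp)).clm_apply continuous_const
  · exact φ.hasCompactSupport.fderiv_apply ℝ (EuclideanSpace.single i 1)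

theorem IsWeakPartial.zero : IsWeakPartial Ω i 0 0 := by
  intro φ
  have h : ∀ ψ : Euc d → ℝ, ∫ x in (Ω : Set (Euc d)), (0 : L2 Ω) x * ψ x = 0 := by
    intro ψ
    refine integral_eq_zero_of_ae ?_
    filter_upwards [Lp.coeFn_zero ℝ 2
      ((volume : Measure (Euc d)).restrict (Ω : Set (Euc d)))] with x hx
    rw [hx, Pi.zero_apply, zero_mul]
  rw [h, h, neg_zero]

theorem IsWeakPartial.add {u v g h : L2 Ω} (hu : IsWeakPartial Ω i u g)
    (hv : IsWeakPartial Ω i v h) : IsWeakPartial Ω i (u + v) (g + h) := by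
  intro φ
  have key : ∀ (a b : L2 Ω) (ψ : Euc d → ℝ),
      Integrable (fun x => a x * ψ x)
        ((volume : Measure (Euc d)).restrict (Ω : Set (Euc d))) →
      Integrable (fun x => b x * ψ x)
        ((volume : Measure (Euc d)).restrict (Ω : Set (Euc d))) →
      ∫ x in (Ω : Set (Euc d)), (a + b : L2 Ω) x * ψ x
        = (∫ x in (Ω : Set (Euc d)), a x * ψ x) + ∫ x in (Ω : Set (Euc d)), b x * ψ x := by
    intro a b ψ ha hb
    rw [← integral_add ha hb]
    refine integral_congr_ae ?_
    filter_upwards [Lp.coeFn_add a b] with x hx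
    rw [hx, Pi.add_apply, add_mul]
  rw [key _ _ _ (integrable_mul_partialDeriv u φ) (integrable_mul_partialDeriv v φ),
    key _ _ _ (integrable_mul_test g φ.continuous φ.hasCompactSupport)
      (integrable_mul_test h φ.continuous φ.hasCompactSupport), hu φ, hv φ, neg_add]

theorem IsWeakPartial.smul {u g : L2 Ω} (c : ℝ) (hu : IsWeakPartial Ω i u g) :
    IsWeakPartial Ω i (c • u) (c • g) := by
  intro φ
  have key : ∀ (a : L2 Ω) (ψ : Euc d → ℝ),
      ∫ x in (Ω : Set (Euc d)), (c • a : L2 Ω) x * ψ x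
        = c * ∫ x in (Ω : Set (Euc d)), a x * ψ x := by
    intro a ψ
    rw [← integral_const_mul]
    refine integral_congr_ae ?_
    filter_upwards [Lp.coeFn_smul c a] with x hx
    rw [hx, Pi.smul_apply, smul_eq_mul, mul_assoc]
  rw [key, key, hu φ, mul_neg]

end linearity

/-- The Sobolev space `H¹(Ω)`: pairs `(u, ∇u)` of a function in `L²(Ω)` and its weak gradient in
`L²(Ω)^d` (which is determined by `u`). The inherited norm is
`‖u‖_{1,Ω} = (‖u‖² + ‖∇u‖²)^{1/2}`. -/
def H1 {d : ℕ} (Ω : Opens (Euc d)) : Submodule ℝ (WithLp 2 (L2 Ω × L2Pow (Fin d) Ω)) where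
  carrier := {p | ∀ i, IsWeakPartial Ω i p.fst (p.snd i)}
  zero_mem' := fun _ => IsWeakPartial.zero
  add_mem' := fun hp hq i => (hp i).add (hq i)
  smul_mem' := fun c _ hp i => (hp i).smul c

/-- The embedding `H¹(Ω) → L²(Ω)`. -/
def h1ToL2 {d : ℕ} {Ω : Opens (Euc d)} (v : H1 Ω) : L2 Ω := v.1.fst

/-- The gradient `∇ : H¹(Ω) → L²(Ω)^d`. -/
def h1Grad {d : ℕ} {Ω : Opens (Euc d)} (v : H1 Ω) : L2Pow (Fin d) Ω := v.1.snd

/-- `H¹₀(Ω)`: the closure in `H¹(Ω)` of the smooth functions with compact support in `Ω`. -/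
def H10 {d : ℕ} (Ω : Opens (Euc d)) : Submodule ℝ (H1 Ω) :=
  (Submodule.span ℝ {v : H1 Ω | ∃ φ : 𝓓(Ω, ℝ),
    h1ToL2 v =ᵐ[(volume : Measure (Euc d)).restrict (Ω : Set (Euc d))] φ}).topologicalClosure

/-- The embedding `H¹₀(Ω) → L²(Ω)`. -/
def h10ToL2 {d : ℕ} {Ω : Opens (Euc d)} (v : H10 Ω) : L2 Ω := h1ToL2 (v : H1 Ω)

/-- The gradient `∇ : H¹₀(Ω) → L²(Ω)^d`. -/
def h10Grad {d : ℕ} {Ω : Opens (Euc d)} (v : H10 Ω) : L2Pow (Fin d) Ω := h1Grad (v : H1 Ω)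

/-- The Sobolev space `H²(Ω)`: functions `u ∈ H¹(Ω)` together with all their weak second
derivatives `∂ⱼ∂ᵢ u ∈ L²(Ω)` (stored at the index `(i, j)` and determined by `u`). The inherited
norm is `(‖u‖²_{1,Ω} + ∑ᵢⱼ ‖∂ⱼ∂ᵢ u‖²)^{1/2}`. -/
def H2 {d : ℕ} (Ω : Opens (Euc d)) :
    Submodule ℝ (WithLp 2 (H1 Ω × L2Pow (Fin d × Fin d) Ω)) where
  carrier := {p | ∀ i j, IsWeakPartial Ω j (h1Grad p.fst i) (p.snd (i, j))}
  zero_mem' := fun _ _ => IsWeakPartial.zero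
  add_mem' := fun hp hq i j => (hp i j).add (hq i j)
  smul_mem' := fun c _ hp i j => (hp i j).smul c

/-- The embedding `H²(Ω) → H¹(Ω)`. -/
def h2ToH1 {d : ℕ} {Ω : Opens (Euc d)} (v : H2 Ω) : H1 Ω := v.1.fst

/-- The embedding `H²(Ω) → L²(Ω)`. -/
def h2ToL2 {d : ℕ} {Ω : Opens (Euc d)} (v : H2 Ω) : L2 Ω := h1ToL2 (h2ToH1 v)

/-- The gradient `∇ : H²(Ω) → L²(Ω)^d`. -/
def h2Grad {d : ℕ} {Ω : Opens (Euc d)} (v : H2 Ω) : L2Pow (Fin d) Ω := h1Grad (h2ToH1 v)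

/-- The Laplacian `Δ : H²(Ω) → L²(Ω)`, `Δ v = ∑ᵢ ∂ᵢ∂ᵢ v`. -/
def h2Laplacian {d : ℕ} {Ω : Opens (Euc d)} (v : H2 Ω) : L2 Ω := ∑ i, v.1.snd (i, i)

/-- `C` is a Poincaré–Friedrichs constant of `Ω`: `‖v‖ ≤ C ‖∇v‖` for all `v ∈ H¹₀(Ω)`. -/
def IsPoincareConst {d : ℕ} (Ω : Opens (Euc d)) (C : ℝ) : Prop :=
  ∀ v : H10 Ω, ‖h10ToL2 v‖ ≤ C * ‖h10Grad v‖

/-- `u` is a strong solution of `ü = Δu + f`, `u(0) = u̇(0) = 0`, on `Ω` with homogeneous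
Dirichlet condition. The values of `f` and `u` at negative times are irrelevant, and derivatives
at `t = 0` are right derivatives. -/
structure IsStrongSolution {d : ℕ} (Ω : Opens (Euc d)) (f : ℝ → H10 Ω) (u : ℝ → H2 Ω) :
    Prop where
  /-- `u ∈ C²([0,∞); L²(Ω))` -/
  contDiff_L2 : ContDiffOn ℝ 2 (fun t => h2ToL2 (u t)) (Ici 0)
  /-- `u ∈ C¹([0,∞); H¹₀(Ω))` -/
  contDiff_H10 : ∃ w : ℝ → H10 Ω, ContDiffOn ℝ 1 w (Ici 0) ∧
    ∀ t ≥ 0, (w t : H1 Ω) = h2ToH1 (u t)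
  /-- `u ∈ C([0,∞); H²(Ω))` -/
  continuous_H2 : ContinuousOn u (Ici 0)
  /-- the wave equation, in `L²(Ω)`, for all `t ≥ 0` -/
  wave : ∀ t ≥ 0, derivWithin (derivWithin (fun s => h2ToL2 (u s)) (Ici 0)) (Ici 0) t
    = h2Laplacian (u t) + h10ToL2 (f t)
  /-- `u(0) = 0` -/
  init : h2ToL2 (u 0) = 0
  /-- `u̇(0) = 0` -/
  init_deriv : derivWithin (fun s => h2ToL2 (u s)) (Ici 0) 0 = 0

end DirichletWave

end

open DirichletWave

/-!
The wave equation is a first-order system with a skew-adjoint generator, once the Dirichlet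
Laplacian of the ball is known to be invertible with domain `H² ∩ H¹₀`.

*Elliptic regularity.* Integrating `∂ᵢ xᵢ = 1` by parts against `φ²` gives the Poincaré–Friedrichs
inequality (`isPoincareConst_of_abs_le`). On the ball of radius `ρ`, the problem `Δu = g`, `u = 0`
on the sphere, has a polynomial solution `u = (ρ² - |x|²) q` for each polynomial `g`, because
`q ↦ Δ((ρ² - |x|²) q)` is injective and does not raise degrees
(`exists_polyLaplacian_ballPoly_mul_eq`). For such `u`, `‖Δu‖² - ‖D²u‖²` is the integral of the
divergence of `Δu ∇u - D²u ∇u`, a field that points outwards on the sphere because the ball is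
convex. Hence `‖D²u‖ ≤ ‖Δu‖` (`sum_norm_sq_hess_le`); the boundary integral is avoided by means of
cut-off functions (`setIntegral_divergence_nonneg`). As polynomials are dense in `L²`, the solution
operator extends to a bounded map from `L²` to `H² ∩ H¹₀` (`exists_solution_operator`).

*Existence.* In the energy space of pairs `(∇a, b)`, `a ∈ H¹₀`, `b ∈ L²`, the bounded operator
`J (∇a, b) = (∇Δ⁻¹b, a)` is injective, and skew-adjoint by Green's identity (`green`). So `J⁻¹`
generates a group of isometries (`exists_isUnitaryGroup`, by Yosida approximation), and Duhamel's
formula (`exists_duhamel`) with source `(∇f, 0)` yields `W = (∇u̇, Δu)`. This `W` is bounded by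
`∫ ‖∇f‖`, and `J W = (∇u, u̇)` by `∫ ‖f‖`: these are the two energy estimates
(`exists_wave_system`). The estimate of `‖u‖` follows from the one of `‖∇u‖`.

*Uniqueness.* The energy `‖∇w‖² + ‖ẇ‖²` of the difference of two solutions is constant
(`eq_zero_of_energy`).
-/

open Filter Topology
open scoped InnerProductSpace

namespace DirichletWave
/-! ### Groups of isometries generated by the inverse of a skew-adjoint operator -/

section group

variable {X : Type*} [NormedAddCommGroup X] [InnerProductSpace ℝ X]

/-- A strongly continuous group of isometries whose generator is `J⁻¹`. -/
structure IsUnitaryGroup (J : X →L[ℝ] X) (S : ℝ → X →L[ℝ] X) : Prop where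
  norm_apply : ∀ t x, ‖S t x‖ = ‖x‖
  zero_apply : ∀ x, S 0 x = x
  add_apply : ∀ s t x, S (s + t) x = S s (S t x)
  comm : ∀ t x, S t (J x) = J (S t x)
  cont : ∀ x, Continuous fun t => S t x
  hasDerivAt : ∀ x t, HasDerivAt (fun t => S t (J x)) (S t x) t

variable {J : X →L[ℝ] X} {S : ℝ → X →L[ℝ] X}

theorem IsUnitaryGroup.tendsto_apply (hS : IsUnitaryGroup J S) {α : Type*} {l : Filter α}
    {r : α → ℝ} {t : ℝ} {y : α → X} {z : X} (hr : Tendsto r l (𝓝 t)) (hy : Tendsto y l (𝓝 z)) :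
    Tendsto (fun a => S (r a) (y a)) l (𝓝 (S t z)) := by
  have h1 : Tendsto (fun a => S (r a) (y a - z)) l (𝓝 0) := by
    rw [tendsto_zero_iff_norm_tendsto_zero]
    simp_rw [hS.norm_apply]
    exact tendsto_iff_norm_sub_tendsto_zero.1 hy
  simpa using h1.add (((hS.cont z).tendsto t).comp hr)

theorem IsUnitaryGroup.hasDerivAt_comp (hS : IsUnitaryGroup J S) {Y : ℝ → X} {Y' : X} {t : ℝ}
    (hY : HasDerivAt Y Y' t) :
    HasDerivAt (fun s => S s (J (Y s))) (S t (Y t) + J (S t Y')) t := by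
  have h1 := hasDerivAt_iff_tendsto_slope.1 (hS.hasDerivAt (Y t) t)
  have h2 := hasDerivAt_iff_tendsto_slope.1 (J.hasFDerivAt.comp_hasDerivAt t hY)
  have hid : Tendsto (fun s : ℝ => s) (𝓝[≠] t) (𝓝 t) := tendsto_id.mono_left nhdsWithin_le_nhds
  rw [hasDerivAt_iff_tendsto_slope, ← hS.comm]
  refine (h1.add (hS.tendsto_apply hid h2)).congr fun s => ?_
  simp only [slope, vsub_eq_sub, Function.comp_apply, map_smul, ← smul_add, map_sub]
  congr 1; abel

variable [CompleteSpace X]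

/-- The resolvent `(ε - J²)⁻¹`. -/
noncomputable def sqResolvent (J : X →L[ℝ] X) (ε : ℝ) : X →L[ℝ] X :=
  Ring.inverse (ε • (1 : X →L[ℝ] X) - J * J)

variable {ε : ℝ}

theorem inner_skew (hJ : ContinuousLinearMap.adjoint J = -J) (x y : X) :
    ⟪J x, y⟫_ℝ = -⟪x, J y⟫_ℝ := by
  rw [← ContinuousLinearMap.adjoint_inner_right, hJ, neg_apply, inner_neg_right]

theorem inner_sub_sq (hJ : ContinuousLinearMap.adjoint J = -J) (x : X) :
    ⟪(ε • (1 : X →L[ℝ] X) - J * J) x, x⟫_ℝ = ε * ‖x‖ ^ 2 + ‖J x‖ ^ 2 := by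
  simp only [sub_apply, smul_apply,
    one_apply_eq_self, mul_apply_eq_comp, inner_sub_left,
    real_inner_smul_left, real_inner_self_eq_norm_sq]
  rw [inner_skew hJ (J x) x, real_inner_self_eq_norm_sq]; ring

theorem isUnit_sub_sq (hJ : ContinuousLinearMap.adjoint J = -J) (hε : 0 < ε) :
    IsUnit (ε • (1 : X →L[ℝ] X) - J * J) := by
  refine ContinuousLinearMap.isUnit_of_forall_le_norm_inner_map _ (c := ⟨ε, hε.le⟩) hε fun x => ?_
  rw [inner_sub_sq hJ, Real.norm_eq_abs]
  refine le_trans ?_ (le_abs_self _)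
  change ‖x‖ ^ 2 * ε ≤ _
  nlinarith [sq_nonneg ‖J x‖]

theorem sub_sq_mul_sqResolvent (hJ : ContinuousLinearMap.adjoint J = -J) (hε : 0 < ε) :
    (ε • (1 : X →L[ℝ] X) - J * J) * sqResolvent J ε = 1 :=
  Ring.mul_inverse_cancel _ (isUnit_sub_sq hJ hε)

theorem commute_sqResolvent (hJ : ContinuousLinearMap.adjoint J = -J) (hε : 0 < ε)
    {A : X →L[ℝ] X} (hA : Commute A J) : Commute A (sqResolvent J ε) := by
  have h : Commute A (ε • (1 : X →L[ℝ] X) - J * J) :=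
    (((Commute.one_right A).smul_right ε)).sub_right (hA.mul_right hA)
  have h1 := sub_sq_mul_sqResolvent hJ hε
  have h2 : sqResolvent J ε * (ε • (1 : X →L[ℝ] X) - J * J) = 1 :=
    Ring.inverse_mul_cancel _ (isUnit_sub_sq hJ hε)
  calc A * sqResolvent J ε
      = sqResolvent J ε * (ε • (1 : X →L[ℝ] X) - J * J) * A * sqResolvent J ε := by
        rw [h2, one_mul]
    _ = sqResolvent J ε * A * ((ε • (1 : X →L[ℝ] X) - J * J) * sqResolvent J ε) := by
        rw [mul_assoc (sqResolvent J ε), ← h.eq]; noncomm_ring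
    _ = sqResolvent J ε * A := by rw [h1, mul_one]

theorem norm_smul_sqResolvent_le (hJ : ContinuousLinearMap.adjoint J = -J) (hε : 0 < ε) (x : X) :
    ‖ε • sqResolvent J ε x‖ ≤ ‖x‖ := by
  set y := sqResolvent J ε x with hy
  have hx : (ε • (1 : X →L[ℝ] X) - J * J) y = x := by
    have := DFunLike.congr_fun (sub_sq_mul_sqResolvent hJ hε) x
    simpa using this
  have h1 := inner_sub_sq (ε := ε) hJ y
  rw [hx] at h1
  have h2 := real_inner_le_norm x y
  rw [norm_smul, Real.norm_of_nonneg hε.le]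
  by_cases h0 : ‖y‖ = 0
  · rw [h0]; simp
  have : 0 < ‖y‖ := lt_of_le_of_ne (norm_nonneg _) (Ne.symm h0)
  nlinarith [sq_nonneg ‖J y‖]

theorem denseRange_of_skew (hJ : ContinuousLinearMap.adjoint J = -J)
    (hinj : Function.Injective J) : DenseRange J := by
  have h : J.range.topologicalClosure = ⊤ := by
    rw [Submodule.topologicalClosure_eq_top_iff, ContinuousLinearMap.orthogonal_range, hJ]
    refine (Submodule.eq_bot_iff _).2 fun x hx => ?_
    have : J x = 0 := by simpa using hx
    exact hinj (by rw [this, map_zero])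
  intro x
  have hx : x ∈ J.range.topologicalClosure := by rw [h]; trivial
  exact hx

/-- `J (J x)` is recovered from the resolvent: `(ε - J²)⁻¹ J² x = ε (ε - J²)⁻¹ x - x`. -/
theorem sqResolvent_apply_sq (hJ : ContinuousLinearMap.adjoint J = -J) (hε : 0 < ε) (x : X) :
    sqResolvent J ε (J (J x)) = ε • sqResolvent J ε x - x := by
  have h2 : sqResolvent J ε * (ε • (1 : X →L[ℝ] X) - J * J) = 1 :=
    Ring.inverse_mul_cancel _ (isUnit_sub_sq hJ hε)
  have h3 := DFunLike.congr_fun h2 x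
  simp only [mul_apply_eq_comp, sub_apply, smul_apply, one_apply_eq_self, map_sub, map_smul] at h3
  nth_rewrite 3 [← h3]
  abel

/-- The error `εₙ (εₙ - J²)⁻¹`, `εₙ = 1 / (n + 1)`, in the Yosida approximation of `J⁻¹`. -/
noncomputable def residual (J : X →L[ℝ] X) (n : ℕ) : X →L[ℝ] X :=
  (1 / ((n : ℝ) + 1)) • sqResolvent J (1 / ((n : ℝ) + 1))

/-- The Yosida approximations `-J (εₙ - J²)⁻¹`, `εₙ = 1 / (n + 1)`, of the unbounded
operator `J⁻¹`. -/
noncomputable def yosida (J : X →L[ℝ] X) (n : ℕ) : X →L[ℝ] X :=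
  -(J * sqResolvent J (1 / ((n : ℝ) + 1)))

theorem tendsto_residual (hJ : ContinuousLinearMap.adjoint J = -J)
    (hinj : Function.Injective J) (x : X) :
    Tendsto (fun n : ℕ => residual J n x) atTop (𝓝 0) := by
  have hpos : ∀ n : ℕ, (0 : ℝ) < 1 / ((n : ℝ) + 1) := fun n => by positivity
  have hle : ∀ n y, ‖residual J n y‖ ≤ ‖y‖ := fun n y => norm_smul_sqResolvent_le hJ (hpos n) y
  rw [Metric.tendsto_atTop]
  intro δ hδ
  have hd : DenseRange (fun z => J (J z)) :=
    (denseRange_of_skew hJ hinj).comp (denseRange_of_skew hJ hinj) J.continuous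
  obtain ⟨z, hz⟩ := hd.exists_dist_lt x (half_pos hδ)
  have hlim : Tendsto (fun n : ℕ => (1 / ((n : ℝ) + 1)) * (2 * ‖z‖)) atTop (𝓝 0) := by
    simpa using (tendsto_one_div_add_atTop_nhds_zero_nat (𝕜 := ℝ)).mul_const (2 * ‖z‖)
  obtain ⟨N, hN⟩ := (hlim.eventually (gt_mem_nhds (half_pos hδ))).exists_forall_of_atTop
  refine ⟨N, fun n hn => ?_⟩
  have hsplit : residual J n x = residual J n (x - J (J z))
      + (1 / ((n : ℝ) + 1)) • (residual J n z - z) := by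
    have h1 : residual J n (J (J z)) = (1 / ((n : ℝ) + 1)) • (residual J n z - z) :=
      congrArg _ (sqResolvent_apply_sq hJ (hpos n) z)
    rw [map_sub, h1, sub_add_cancel]
  rw [dist_zero_right, hsplit]
  have h1 := hle n (x - J (J z))
  have h3 : ‖(1 / ((n : ℝ) + 1)) • (residual J n z - z)‖ ≤ (1 / ((n : ℝ) + 1)) * (2 * ‖z‖) := by
    rw [norm_smul, Real.norm_of_nonneg (hpos n).le]
    refine mul_le_mul_of_nonneg_left ?_ (hpos n).le
    exact (norm_sub_le _ _).trans (by linarith [hle n z])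
  rw [dist_eq_norm] at hz
  exact (norm_add_le _ _).trans_lt (by linarith [hN n hn])

theorem yosida_apply (hJ : ContinuousLinearMap.adjoint J = -J) (n : ℕ) (y : X) :
    yosida J n (J y) = y - residual J n y := by
  have hpos : (0 : ℝ) < 1 / ((n : ℝ) + 1) := by positivity
  have h := DFunLike.congr_fun (commute_sqResolvent hJ hpos (Commute.refl J)).eq (J y)
  simp only [mul_apply_eq_comp] at h
  simp only [yosida, residual, neg_apply, mul_apply_eq_comp, h, sqResolvent_apply_sq hJ hpos,
    smul_apply, neg_sub]

theorem commute_yosida (hJ : ContinuousLinearMap.adjoint J = -J) {A : X →L[ℝ] X}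
    (hA : Commute A J) (n : ℕ) : Commute A (yosida J n) :=
  (hA.mul_right (commute_sqResolvent hJ (by positivity) hA)).neg_right

theorem inner_yosida_self (hJ : ContinuousLinearMap.adjoint J = -J) (n : ℕ) (x : X) :
    ⟪yosida J n x, x⟫_ℝ = 0 := by
  have hpos : (0 : ℝ) < 1 / ((n : ℝ) + 1) := by positivity
  have h0 : ∀ z, ⟪J z, z⟫_ℝ = 0 := fun z => by
    have := inner_skew hJ z z
    rw [real_inner_comm z (J z)] at this
    linarith [real_inner_comm z (J z)]
  have h2 := DFunLike.congr_fun (sub_sq_mul_sqResolvent hJ hpos) x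
  simp only [mul_apply_eq_comp, sub_apply, smul_apply, one_apply_eq_self] at h2
  simp only [yosida, neg_apply, mul_apply_eq_comp, inner_neg_left]
  nth_rewrite 2 [← h2]
  rw [inner_sub_right, real_inner_smul_right, h0, real_inner_comm, h0]
  simp

open NormedSpace in
theorem norm_exp_smul_apply {B : X →L[ℝ] X} (hB : ∀ x, ⟪B x, x⟫_ℝ = 0) (t : ℝ) (x : X) :
    ‖exp (t • B) x‖ = ‖x‖ := by
  have hd : ∀ s : ℝ, HasDerivAt (fun s : ℝ => exp (s • B) x) (B (exp (s • B) x)) s := fun s =>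
    (hasDerivAt_exp_smul_const' B s).clm_apply (hasDerivAt_const s x) |>.congr_deriv (by simp)
  have hE : ∀ s : ℝ, HasDerivAt (fun s : ℝ => ‖exp (s • B) x‖ ^ 2) 0 s := fun s =>
    (hd s).norm_sq.congr_deriv (by rw [real_inner_comm, hB, mul_zero])
  have h := is_const_of_deriv_eq_zero (fun s => (hE s).differentiableAt) (fun s => (hE s).deriv) t 0
  simp only [zero_smul, exp_zero, one_apply_eq_self] at h
  exact (sq_eq_sq₀ (norm_nonneg _) (norm_nonneg _)).1 h

open NormedSpace in
theorem norm_exp_smul_apply_sub_le {B : X →L[ℝ] X} (hB : ∀ x, ⟪B x, x⟫_ℝ = 0) (t : ℝ) (x : X) :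
    ‖exp (t • B) x - x‖ ≤ |t| * ‖B x‖ := by
  have hd : ∀ s : ℝ, HasDerivAt (fun s : ℝ => exp (s • B) x) (exp (s • B) (B x)) s := fun s =>
    (hasDerivAt_exp_smul_const B s).clm_apply (hasDerivAt_const s x) |>.congr_deriv (by simp)
  have h := convex_univ.norm_image_sub_le_of_norm_hasDerivWithin_le
    (fun s _ => (hd s).hasDerivWithinAt) (fun s _ => (norm_exp_smul_apply hB s (B x)).le)
    (mem_univ (0 : ℝ)) (mem_univ t)
  simpa [mul_comm] using h

open NormedSpace in
theorem norm_exp_yosida_sub_le (hJ : ContinuousLinearMap.adjoint J = -J) (m n : ℕ) (t : ℝ)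
    (y : X) : ‖exp (t • yosida J m) (J y) - exp (t • yosida J n) (J y)‖
      ≤ |t| * ‖residual J n y - residual J m y‖ := by
  have hcomm : Commute (yosida J n) (yosida J m) :=
    commute_yosida hJ ((commute_yosida hJ (Commute.refl J) n).symm) m
  have hB : ∀ x, ⟪(yosida J m - yosida J n) x, x⟫_ℝ = 0 := fun x => by
    rw [sub_apply, inner_sub_left, inner_yosida_self hJ, inner_yosida_self hJ, sub_zero]
  have hsplit : t • yosida J m = t • yosida J n + t • (yosida J m - yosida J n) := by
    rw [← smul_add]; congr 1; abel
  have hc : Commute (t • yosida J n) (t • (yosida J m - yosida J n)) :=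
    ((hcomm.sub_right (Commute.refl _)).smul_left t).smul_right t
  let _ : NormedAlgebra ℚ (X →L[ℝ] X) := NormedAlgebra.restrictScalars ℚ ℝ _
  rw [hsplit, exp_add_of_commute hc, mul_apply_eq_comp, ← map_sub,
    norm_exp_smul_apply (inner_yosida_self hJ n)]
  refine (norm_exp_smul_apply_sub_le hB t (J y)).trans_eq ?_
  rw [sub_apply, yosida_apply hJ, yosida_apply hJ]
  congr 2; abel

open NormedSpace in
/-- The Yosida exponentials are uniformly close to each other on bounded time intervals: the
bound is explicit on the range of `J` and extends by isometry. -/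
theorem cauchySeq_exp_yosida (hJ : ContinuousLinearMap.adjoint J = -J)
    (hinj : Function.Injective J) (x : X) (T : ℝ) {δ : ℝ} (hδ : 0 < δ) :
    ∃ N, ∀ m ≥ N, ∀ n ≥ N, ∀ t, |t| ≤ T →
      ‖exp (t • yosida J m) x - exp (t • yosida J n) x‖ < δ := by
  obtain ⟨y, hy⟩ := (denseRange_of_skew hJ hinj).exists_dist_lt x (by positivity : 0 < δ / 4)
  rw [dist_eq_norm] at hy
  have hT : 0 < |T| + 1 := by positivity
  obtain ⟨N, hN⟩ := (Metric.tendsto_atTop.1 (tendsto_residual hJ hinj y)) (δ / 4 / (|T| + 1))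
    (by positivity)
  refine ⟨N, fun m hm n hn t ht => ?_⟩
  have h1 := hN m hm
  have h2 := hN n hn
  rw [dist_zero_right, lt_div_iff₀ hT] at h1 h2
  have h3 := norm_exp_yosida_sub_le hJ m n t y
  have h4 : |t| * ‖residual J n y - residual J m y‖
      ≤ (|T| + 1) * (‖residual J n y‖ + ‖residual J m y‖) :=
    mul_le_mul (by linarith [le_abs_self T]) (norm_sub_le _ _) (norm_nonneg _) hT.le
  have h5 : exp (t • yosida J m) x - exp (t • yosida J n) x
      = exp (t • yosida J m) (x - J y) - exp (t • yosida J n) (x - J y)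
        + (exp (t • yosida J m) (J y) - exp (t • yosida J n) (J y)) := by
    simp only [map_sub]; abel
  have h6 := norm_exp_smul_apply (inner_yosida_self hJ m) t (x - J y)
  have h7 := norm_exp_smul_apply (inner_yosida_self hJ n) t (x - J y)
  rw [h5]
  refine (norm_add_le _ _).trans_lt ?_
  have h8 := norm_sub_le (exp (t • yosida J m) (x - J y)) (exp (t • yosida J n) (x - J y))
  linarith

open NormedSpace in
/-- **Stone's theorem** for an invertible generator: the inverse of an injective bounded
skew-adjoint operator generates a strongly continuous group of isometries. -/
theorem exists_isUnitaryGroup (hJ : ContinuousLinearMap.adjoint J = -J)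
    (hinj : Function.Injective J) : ∃ S : ℝ → X →L[ℝ] X, IsUnitaryGroup J S := by
  let _ : NormedAlgebra ℚ (X →L[ℝ] X) := NormedAlgebra.restrictScalars ℚ ℝ _
  have hlim : ∀ (t : ℝ) (x : X), ∃ z,
      Tendsto (fun n => exp (t • yosida J n) x) atTop (𝓝 z) := by
    intro t x
    refine cauchySeq_tendsto_of_complete (Metric.cauchySeq_iff.2 fun δ hδ => ?_)
    obtain ⟨N, hN⟩ := cauchySeq_exp_yosida hJ hinj x |t| hδ
    exact ⟨N, fun m hm n hn => by simpa [dist_eq_norm] using hN m hm n hn t le_rfl⟩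
  choose F hF using hlim
  let S : ℝ → X →L[ℝ] X := fun t =>
    continuousLinearMapOfTendsto (fun n => exp (t • yosida J n)) (tendsto_pi_nhds.2 (hF t))
  have hS : ∀ t x, Tendsto (fun n => exp (t • yosida J n) x) atTop (𝓝 (S t x)) := hF
  have hunif : ∀ x, TendstoLocallyUniformlyOn (fun n t => exp (t • yosida J n) x)
      (fun t => S t x) atTop univ := fun x => by
    rw [tendstoLocallyUniformlyOn_univ, Metric.tendstoLocallyUniformly_iff]
    intro δ hδ t
    obtain ⟨N, hN⟩ := cauchySeq_exp_yosida hJ hinj x (|t| + 1) (half_pos hδ)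
    refine ⟨Metric.ball t 1, Metric.ball_mem_nhds t one_pos, ?_⟩
    filter_upwards [eventually_ge_atTop N] with n hn s hs
    have hst : |s| ≤ |t| + 1 := by
      rw [Metric.mem_ball, Real.dist_eq] at hs
      have := abs_sub_abs_le_abs_sub s t
      linarith
    have h1 : ‖S s x - exp (s • yosida J n) x‖ ≤ δ / 2 :=
      le_of_tendsto ((hS s x).sub_const _).norm
        ((eventually_ge_atTop N).mono fun m hm => (hN m hm n hn s hst).le)
    rw [dist_eq_norm]
    linarith
  have hnorm : ∀ t x, ‖S t x‖ = ‖x‖ := fun t x =>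
    tendsto_nhds_unique (hS t x).norm (by
      simp_rw [fun n => norm_exp_smul_apply (inner_yosida_self hJ n) t x]
      exact tendsto_const_nhds)
  refine ⟨S, hnorm, fun x => ?_, fun s t x => ?_, fun t x => ?_, fun x => ?_, fun x t => ?_⟩
  · refine tendsto_nhds_unique (hS 0 x) ?_
    simp
  · have h1 : Tendsto (fun n => exp (s • yosida J n) (exp (t • yosida J n) x)) atTop
        (𝓝 (S s (S t x))) := by
      have h2 : Tendsto (fun n => exp (s • yosida J n) (exp (t • yosida J n) x - S t x)) atTop
          (𝓝 0) := by
        rw [tendsto_zero_iff_norm_tendsto_zero]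
        simp_rw [fun n => norm_exp_smul_apply (inner_yosida_self hJ n) s]
        exact tendsto_iff_norm_sub_tendsto_zero.1 (hS t x)
      have h3 := h2.add (hS s (S t x))
      simpa using h3
    refine tendsto_nhds_unique (hS (s + t) x) (h1.congr fun n => ?_)
    rw [add_smul, exp_add_of_commute (((Commute.refl _).smul_left s).smul_right t)]
    rfl
  · refine tendsto_nhds_unique (hS t (J x))
      (((J.continuous.tendsto _).comp (hS t x)).congr fun n => ?_)
    have h : Commute J (exp (t • yosida J n)) :=
      ((commute_yosida hJ (Commute.refl J) n).smul_right t).exp_right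
    exact DFunLike.congr_fun h.eq x
  · refine continuousOn_univ.1 ((hunif x).continuousOn (Frequently.of_forall fun n => ?_))
    refine Continuous.continuousOn ?_
    exact (exp_continuous.comp (continuous_id.smul continuous_const)).clm_apply continuous_const
  · refine hasDerivAt_of_tendstoLocallyUniformlyOn isOpen_univ
      (f := fun n t => exp (t • yosida J n) (J x))
      (f' := fun n t => exp (t • yosida J n) (yosida J n (J x))) (g' := fun t => S t x) (l := atTop)
      ?_ (Eventually.of_forall fun n s _ => ?_) (fun s _ => hS s (J x)) (mem_univ t)
    · rw [tendstoLocallyUniformlyOn_univ, Metric.tendstoLocallyUniformly_iff]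
      intro δ hδ s
      have h1 := hunif x
      rw [tendstoLocallyUniformlyOn_univ, Metric.tendstoLocallyUniformly_iff] at h1
      obtain ⟨U, hU, h2⟩ := h1 (δ / 2) (half_pos hδ) s
      refine ⟨U, hU, ?_⟩
      filter_upwards [h2, Metric.tendsto_nhds.1 (tendsto_residual hJ hinj x) _ (half_pos hδ)]
        with n hn hn' r hr
      have h3 := hn r hr
      rw [dist_eq_norm] at h3 ⊢
      rw [dist_zero_right, ← norm_exp_smul_apply (inner_yosida_self hJ n) r] at hn'
      rw [yosida_apply hJ, map_sub, sub_sub_eq_add_sub, add_sub_right_comm]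
      exact (norm_add_le _ _).trans_lt (by linarith)
    · exact ((hasDerivAt_exp_smul_const (yosida J n) s).clm_apply
        (hasDerivAt_const s (J x))).congr_deriv (by simp)

/-- **Duhamel's formula**: `W(t) = ∫₀ᵗ S(t-s) G(s) ds` is the mild solution of
`W' = J⁻¹ W + G`, `W(0) = 0`; the equation is written after an application of `J`. -/
theorem exists_duhamel (hJ : ContinuousLinearMap.adjoint J = -J)
    (hinj : Function.Injective J) {G : ℝ → X} (hG : Continuous G) :
    ∃ W : ℝ → X, Continuous W ∧ W 0 = 0 ∧
      (∀ t, HasDerivAt (fun s => J (W s)) (W t + J (G t)) t) ∧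
      (∀ t ≥ 0, ‖W t‖ ≤ ∫ τ in (0 : ℝ)..t, ‖G τ‖) ∧
      ∀ t ≥ 0, ‖J (W t)‖ ≤ ∫ τ in (0 : ℝ)..t, ‖J (G τ)‖ := by
  obtain ⟨S, hS⟩ := exists_isUnitaryGroup hJ hinj
  have hSG : ∀ H : ℝ → X, Continuous H → Continuous fun s => S (-s) (H s) := fun H hH =>
    continuous_iff_continuousAt.2 fun t =>
      hS.tendsto_apply (continuous_neg.tendsto t) (hH.tendsto t)
  set Y : ℝ → X := fun t => ∫ τ in (0 : ℝ)..t, S (-τ) (G τ) with hYdef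
  have hY : ∀ t, HasDerivAt Y (S (-t) (G t)) t := fun t =>
    intervalIntegral.integral_hasDerivAt_right ((hSG G hG).intervalIntegrable _ _)
      ((hSG G hG).stronglyMeasurableAtFilter _ _) (hSG G hG).continuousAt
  have hYc : Continuous Y := continuous_iff_continuousAt.2 fun t => (hY t).continuousAt
  refine ⟨fun t => S t (Y t), ?_, ?_, fun t => ?_, fun t ht => ?_, fun t ht => ?_⟩
  · exact continuous_iff_continuousAt.2 fun t => hS.tendsto_apply tendsto_id (hYc.tendsto t)
  · simp [hYdef]
  · have h := hS.hasDerivAt_comp (hY t)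
    rw [← hS.add_apply, add_neg_cancel, hS.zero_apply] at h
    simpa only [← hS.comm] using h
  · rw [hS.norm_apply]
    refine (intervalIntegral.norm_integral_le_integral_norm ht).trans_eq ?_
    simp_rw [hS.norm_apply]
  · rw [← hS.comm, hS.norm_apply, ← ContinuousLinearMap.intervalIntegral_comp_comm J
      ((hSG G hG).intervalIntegrable _ _)]
    refine (intervalIntegral.norm_integral_le_integral_norm ht).trans_eq ?_
    simp_rw [← hS.comm, hS.norm_apply]

end group
/-! ### Weak derivatives and the Sobolev spaces `H¹`, `H¹₀`, `H²` -/

section sobolev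

variable {d : ℕ} {Ω : Opens (Euc d)}

theorem inner_eq_integral (u g : L2 Ω) {ψ : Euc d → ℝ}
    (h : g =ᵐ[(volume : Measure (Euc d)).restrict (Ω : Set (Euc d))] ψ) :
    ⟪u, g⟫_ℝ = ∫ x in (Ω : Set (Euc d)), u x * ψ x := by
  rw [L2.inner_def]
  refine integral_congr_ae ?_
  filter_upwards [h] with x hx
  rw [hx, real_inner_eq_re_inner]
  simp [mul_comm]

theorem continuous_partialDeriv {ψ : Euc d → ℝ} (hψ : ContDiff ℝ 1 ψ) (i : Fin d) :
    Continuous (partialDeriv i ψ) :=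
  (hψ.continuous_fderiv one_ne_zero).clm_apply continuous_const

theorem contDiff_one_test (φ : 𝓓(Ω, ℝ)) : ContDiff ℝ 1 φ :=
  φ.contDiff.of_le (by exact_mod_cast le_top)

theorem hasCompactSupport_partialDeriv (φ : 𝓓(Ω, ℝ)) (i : Fin d) :
    HasCompactSupport (partialDeriv i φ) :=
  φ.hasCompactSupport.fderiv_apply ℝ (EuclideanSpace.single i 1)

theorem memLp_test (φ : 𝓓(Ω, ℝ)) :
    MemLp φ 2 ((volume : Measure (Euc d)).restrict (Ω : Set (Euc d))) :=
  φ.continuous.memLp_of_hasCompactSupport φ.hasCompactSupport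

theorem memLp_partialDeriv_test (i : Fin d) (φ : 𝓓(Ω, ℝ)) :
    MemLp (partialDeriv i φ) 2 ((volume : Measure (Euc d)).restrict (Ω : Set (Euc d))) :=
  (continuous_partialDeriv (contDiff_one_test φ) i).memLp_of_hasCompactSupport
    (hasCompactSupport_partialDeriv φ i)

/-- The class of a test function in `L²(Ω)`. -/
noncomputable def testL2 (φ : 𝓓(Ω, ℝ)) : L2 Ω := (memLp_test φ).toLp

/-- The class of `∂ᵢ φ` in `L²(Ω)`, for a test function `φ`. -/
noncomputable def testPartial (i : Fin d) (φ : 𝓓(Ω, ℝ)) : L2 Ω :=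
  (memLp_partialDeriv_test i φ).toLp

theorem coeFn_testL2 (φ : 𝓓(Ω, ℝ)) :
    testL2 φ =ᵐ[(volume : Measure (Euc d)).restrict (Ω : Set (Euc d))] φ :=
  MemLp.coeFn_toLp _

theorem coeFn_testPartial (i : Fin d) (φ : 𝓓(Ω, ℝ)) :
    testPartial i φ =ᵐ[(volume : Measure (Euc d)).restrict (Ω : Set (Euc d))]
      partialDeriv i φ :=
  MemLp.coeFn_toLp _

theorem isWeakPartial_iff_inner {i : Fin d} {u g : L2 Ω} :
    IsWeakPartial Ω i u g ↔ ∀ φ : 𝓓(Ω, ℝ), ⟪u, testPartial i φ⟫_ℝ = -⟪g, testL2 φ⟫_ℝ := by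
  refine forall_congr' fun φ => ?_
  rw [inner_eq_integral u _ (coeFn_testPartial i φ), inner_eq_integral g _ (coeFn_testL2 φ)]

theorem isClosed_isWeakPartial {Y : Type*} [TopologicalSpace Y] (i : Fin d) {u g : Y → L2 Ω}
    (hu : Continuous u) (hg : Continuous g) : IsClosed {y | IsWeakPartial Ω i (u y) (g y)} := by
  simp only [isWeakPartial_iff_inner, ofPred_forall]
  exact isClosed_iInter fun φ => isClosed_eq (hu.inner continuous_const)
    (hg.inner continuous_const).neg

/-- The fundamental lemma of the calculus of variations: a function orthogonal to all test
functions vanishes. -/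
theorem eq_zero_of_forall_inner_test {g : L2 Ω} (h : ∀ φ : 𝓓(Ω, ℝ), ⟪g, testL2 φ⟫_ℝ = 0) :
    g = 0 := by
  rw [Lp.eq_zero_iff_ae_eq_zero]
  have hloc : LocallyIntegrableOn g (Ω : Set (Euc d)) volume :=
    locallyIntegrableOn_of_locallyIntegrable_restrict
      ((Lp.memLp g).locallyIntegrable one_le_two)
  refine (ae_restrict_iff' Ω.isOpen.measurableSet).2
    (Ω.isOpen.ae_eq_zero_of_integral_contDiff_smul_eq_zero hloc fun ψ h1 h2 h3 => ?_)
  have h4 := h ⟨ψ, h1, h2, h3⟩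
  rw [inner_eq_integral g _ (coeFn_testL2 _)] at h4
  rw [← h4, ← setIntegral_eq_integral_of_forall_compl_eq_zero (s := (Ω : Set (Euc d)))]
  · exact integral_congr_ae (Eventually.of_forall fun x => mul_comm _ _)
  · intro x hx
    have : ψ x = 0 := by
      by_contra h0
      exact hx (h3 (subset_tsupport _ h0))
    rw [this, zero_smul]

theorem IsWeakPartial.unique {i : Fin d} {u g h : L2 Ω} (hg : IsWeakPartial Ω i u g)
    (hh : IsWeakPartial Ω i u h) : g = h := by
  rw [isWeakPartial_iff_inner] at hg hh
  refine sub_eq_zero.1 (eq_zero_of_forall_inner_test fun φ => ?_)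
  rw [inner_sub_left]
  linarith [hg φ, hh φ]

/-- Integration by parts against a test function. -/
theorem setIntegral_mul_partialDeriv {ψ : Euc d → ℝ} (hψ : ContDiff ℝ 1 ψ) (i : Fin d)
    (φ : 𝓓(Ω, ℝ)) :
    ∫ x in (Ω : Set (Euc d)), ψ x * partialDeriv i φ x
      = -∫ x in (Ω : Set (Euc d)), partialDeriv i ψ x * φ x := by
  have h0 : ∀ x ∉ (Ω : Set (Euc d)), φ x = 0 := fun x hx => by
    by_contra h
    exact hx (φ.tsupport_subset (subset_tsupport _ h))
  have h1 : ∀ x ∉ (Ω : Set (Euc d)), partialDeriv i φ x = 0 := fun x hx => by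
    by_contra h
    refine hx (φ.tsupport_subset (tsupport_fderiv_subset ℝ (subset_tsupport _ fun h' => h ?_)))
    rw [partialDeriv, h', zero_apply]
  rw [setIntegral_eq_integral_of_forall_compl_eq_zero fun x hx => by rw [h1 x hx, mul_zero],
    setIntegral_eq_integral_of_forall_compl_eq_zero fun x hx => by rw [h0 x hx, mul_zero]]
  have hcs := φ.hasCompactSupport
  refine integral_mul_fderiv_eq_neg_fderiv_mul_of_integrable
    (f := ψ) (g := φ) (v := EuclideanSpace.single i 1) ?_ ?_ ?_
    (fun x _ => (hψ.differentiable one_ne_zero).differentiableAt)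
    (fun x _ => ((contDiff_one_test φ).differentiable one_ne_zero).differentiableAt)
  · exact ((continuous_partialDeriv hψ i).mul φ.continuous).integrable_of_hasCompactSupport
      hcs.mul_left
  · exact (hψ.continuous.mul
      (continuous_partialDeriv (contDiff_one_test φ) i)).integrable_of_hasCompactSupport
      (hasCompactSupport_partialDeriv φ i).mul_left
  · exact (hψ.continuous.mul φ.continuous).integrable_of_hasCompactSupport hcs.mul_left

/-- The classical derivatives of a `C¹` function are weak derivatives. -/
theorem isWeakPartial_of_contDiff {ψ : Euc d → ℝ} (hψ : ContDiff ℝ 1 ψ) {i : Fin d} {u g : L2 Ω}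
    (hu : u =ᵐ[(volume : Measure (Euc d)).restrict (Ω : Set (Euc d))] ψ)
    (hg : g =ᵐ[(volume : Measure (Euc d)).restrict (Ω : Set (Euc d))] partialDeriv i ψ) :
    IsWeakPartial Ω i u g := fun φ => by
  have h := setIntegral_mul_partialDeriv hψ i φ
  have h1 : (fun x => u x * partialDeriv i φ x)
      =ᵐ[(volume : Measure (Euc d)).restrict (Ω : Set (Euc d))]
      fun x => ψ x * partialDeriv i φ x := hu.mul (EventuallyEq.refl _ (partialDeriv i φ))
  have h2 : (fun x => g x * φ x) =ᵐ[(volume : Measure (Euc d)).restrict (Ω : Set (Euc d))]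
      fun x => partialDeriv i ψ x * φ x := hg.mul (EventuallyEq.refl _ φ)
  rw [integral_congr_ae h1, integral_congr_ae h2, h]

-- Shortcuts for the instances inherited from the ambient spaces; without them, instance synthesis
-- through the nested `L²` products is too slow for normed-space lemmas.
noncomputable instance : NormedAddCommGroup (H1 Ω) := Submodule.normedAddCommGroup _

noncomputable instance : NormedSpace ℝ (H1 Ω) := Submodule.normedSpace _

noncomputable instance : NormedAddCommGroup (H10 Ω) := Submodule.normedAddCommGroup _

noncomputable instance : NormedSpace ℝ (H10 Ω) := Submodule.normedSpace _

noncomputable instance : NormedAddCommGroup (H2 Ω) := Submodule.normedAddCommGroup _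

noncomputable instance : NormedSpace ℝ (H2 Ω) := Submodule.normedSpace _

instance : CompleteSpace (H1 Ω) := by
  refine IsClosed.completeSpace_coe (hs := ?_)
  change IsClosed {p : WithLp 2 (L2 Ω × L2Pow (Fin d) Ω) | ∀ i, IsWeakPartial Ω i p.fst (p.snd i)}
  simp only [ofPred_forall]
  refine isClosed_iInter fun i => isClosed_isWeakPartial i ?_ ?_
  · exact (WithLp.fstL 2 ℝ _ _).continuous
  · exact ((PiLp.proj 2 _ i).comp (WithLp.sndL 2 ℝ (L2 Ω) (L2Pow (Fin d) Ω))).continuous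

instance : CompleteSpace (H10 Ω) :=
  IsClosed.completeSpace_coe (hs := Submodule.isClosed_topologicalClosure _)

/-- `h1ToL2` as a continuous linear map. -/
noncomputable def h1ToL2L (Ω : Opens (Euc d)) : H1 Ω →L[ℝ] L2 Ω :=
  (WithLp.fstL 2 ℝ _ _).comp (H1 Ω).subtypeL

/-- `h1Grad` as a continuous linear map. -/
noncomputable def h1GradL (Ω : Opens (Euc d)) : H1 Ω →L[ℝ] L2Pow (Fin d) Ω :=
  (WithLp.sndL 2 ℝ _ _).comp (H1 Ω).subtypeL

/-- `h10ToL2` as a continuous linear map. -/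
noncomputable def h10ToL2L (Ω : Opens (Euc d)) : H10 Ω →L[ℝ] L2 Ω :=
  (h1ToL2L Ω).comp (H10 Ω).subtypeL

/-- `h10Grad` as a continuous linear map. -/
noncomputable def h10GradL (Ω : Opens (Euc d)) : H10 Ω →L[ℝ] L2Pow (Fin d) Ω :=
  (h1GradL Ω).comp (H10 Ω).subtypeL

/-- `h2ToH1` as a continuous linear map. -/
noncomputable def h2ToH1L (Ω : Opens (Euc d)) : H2 Ω →L[ℝ] H1 Ω :=
  (WithLp.fstL 2 ℝ _ _).comp (H2 Ω).subtypeL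

/-- The second derivatives `H²(Ω) → L²(Ω)^{d×d}` as a continuous linear map. -/
noncomputable def h2HessL (Ω : Opens (Euc d)) : H2 Ω →L[ℝ] L2Pow (Fin d × Fin d) Ω :=
  (WithLp.sndL 2 ℝ _ _).comp (H2 Ω).subtypeL

/-- `h2Laplacian` as a continuous linear map. -/
noncomputable def h2LaplacianL (Ω : Opens (Euc d)) : H2 Ω →L[ℝ] L2 Ω :=
  ∑ i : Fin d, (PiLp.proj 2 _ (i, i)).comp (h2HessL Ω)

theorem h2LaplacianL_apply (v : H2 Ω) : h2LaplacianL Ω v = h2Laplacian v := by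
  simp only [h2LaplacianL, sum_apply]
  rfl

instance : CompleteSpace (H2 Ω) := by
  refine IsClosed.completeSpace_coe (hs := ?_)
  change IsClosed {p : WithLp 2 (H1 Ω × L2Pow (Fin d × Fin d) Ω) |
    ∀ i j, IsWeakPartial Ω j (h1Grad p.fst i) (p.snd (i, j))}
  simp only [ofPred_forall]
  refine isClosed_iInter fun i => isClosed_iInter fun j => isClosed_isWeakPartial j ?_ ?_
  · exact ((PiLp.proj 2 _ i).comp ((h1GradL Ω).comp
      (WithLp.fstL 2 ℝ (H1 Ω) (L2Pow (Fin d × Fin d) Ω)))).continuous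
  · exact ((PiLp.proj 2 _ (i, j)).comp
      (WithLp.sndL 2 ℝ (H1 Ω) (L2Pow (Fin d × Fin d) Ω))).continuous

theorem norm_sq_h1 (v : H1 Ω) : ‖v‖ ^ 2 = ‖h1ToL2 v‖ ^ 2 + ‖h1Grad v‖ ^ 2 :=
  WithLp.prod_norm_sq_eq_of_L2 v.1

theorem norm_sq_h2 (v : H2 Ω) : ‖v‖ ^ 2 = ‖h2ToH1 v‖ ^ 2 + ∑ p, ‖v.1.snd p‖ ^ 2 :=
  (WithLp.prod_norm_sq_eq_of_L2 v.1).trans (by rw [PiLp.norm_sq_eq_of_L2]; rfl)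

theorem h1ToL2_injective : Function.Injective (h1ToL2 : H1 Ω → L2 Ω) := by
  intro v w h
  refine Subtype.ext ((WithLp.ofLp_injective 2) (Prod.ext h ?_))
  refine PiLp.ext fun i => ?_
  have hv := v.2 i
  have hw := w.2 i
  change v.1.fst = w.1.fst at h
  rw [← h] at hw
  exact hv.unique hw

theorem h2ToH1_injective : Function.Injective (h2ToH1 : H2 Ω → H1 Ω) := by
  intro v w h
  refine Subtype.ext ((WithLp.ofLp_injective 2) (Prod.ext h ?_))
  refine PiLp.ext fun p => ?_
  have hv := v.2 p.1 p.2
  have hw := w.2 p.1 p.2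
  change v.1.fst = w.1.fst at h
  rw [← h] at hw
  exact hv.unique hw

theorem h10ToL2_injective : Function.Injective (h10ToL2 : H10 Ω → L2 Ω) :=
  h1ToL2_injective.comp Subtype.val_injective

/-- A test function as an element of `H¹(Ω)`. -/
noncomputable def testH1 (φ : 𝓓(Ω, ℝ)) : H1 Ω :=
  ⟨WithLp.toLp 2 (testL2 φ, WithLp.toLp 2 fun i => testPartial i φ), fun i =>
    isWeakPartial_of_contDiff (contDiff_one_test φ) (coeFn_testL2 φ) (coeFn_testPartial i φ)⟩

@[simp] theorem h1ToL2_testH1 (φ : 𝓓(Ω, ℝ)) : h1ToL2 (testH1 φ) = testL2 φ := rfl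

theorem testH1_mem_H10 (φ : 𝓓(Ω, ℝ)) : testH1 φ ∈ H10 Ω :=
  Submodule.le_topologicalClosure _ (Submodule.subset_span ⟨φ, coeFn_testL2 φ⟩)

/-- A closed property of functions in `H¹(Ω)` that holds for all test functions holds on
`H¹₀(Ω)`. -/
theorem H10_induction {p : H1 Ω → Prop} (hp : IsClosed {v | p v}) (h : ∀ φ, p (testH1 φ))
    (v : H10 Ω) : p v := by
  let S : Submodule ℝ (H1 Ω) :=
    { carrier := range testH1
      zero_mem' := ⟨0, h1ToL2_injective (MemLp.toLp_zero (memLp_test 0))⟩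
      add_mem' := by
        rintro _ _ ⟨φ, rfl⟩ ⟨ψ, rfl⟩
        exact ⟨φ + ψ, h1ToL2_injective (MemLp.toLp_add (memLp_test φ) (memLp_test ψ))⟩
      smul_mem' := by
        rintro c _ ⟨φ, rfl⟩
        exact ⟨c • φ, h1ToL2_injective (MemLp.toLp_const_smul c (memLp_test φ))⟩ }
  have hle : Submodule.span ℝ {v : H1 Ω | ∃ φ : 𝓓(Ω, ℝ),
      h1ToL2 v =ᵐ[(volume : Measure (Euc d)).restrict (Ω : Set (Euc d))] φ} ≤ S := by
    refine Submodule.span_le.2 ?_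
    rintro w ⟨φ, hφ⟩
    exact ⟨φ, h1ToL2_injective (Lp.ext ((coeFn_testL2 φ).trans hφ.symm))⟩
  have hv : (v : H1 Ω) ∈ closure (S : Set (H1 Ω)) := closure_mono hle v.2
  refine (hp.closure_subset_iff.2 ?_) hv
  rintro _ ⟨φ, rfl⟩
  exact h φ

/-- **Green's identity** `⟨∇v, ∇w⟩ = -⟨Δv, w⟩` for `v ∈ H²` and `w ∈ H¹₀`. -/
theorem green (v : H2 Ω) (w : H10 Ω) :
    ⟪h2Grad v, h10Grad w⟫_ℝ = -⟪h2Laplacian v, h10ToL2 w⟫_ℝ := by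
  refine H10_induction (p := fun w => ⟪h2Grad v, h1Grad w⟫_ℝ = -⟪h2Laplacian v, h1ToL2 w⟫_ℝ)
    ?_ (fun φ => ?_) w
  · exact isClosed_eq (continuous_const.inner (h1GradL Ω).continuous)
      (continuous_const.inner (h1ToL2L Ω).continuous).neg
  · rw [PiLp.inner_apply, h2Laplacian, sum_inner, ← Finset.sum_neg_distrib]
    exact Finset.sum_congr rfl fun i _ => isWeakPartial_iff_inner.1 (v.2 i i) φ

/-- The **Poincaré–Friedrichs inequality** on a domain that is bounded in direction `i`: for a test
function, integration by parts of `∂ᵢ xᵢ = 1` gives `∫ φ² = -2 ∫ xᵢ φ ∂ᵢφ`. -/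
theorem isPoincareConst_of_abs_le (i : Fin d) {r : ℝ} (hr : ∀ x ∈ Ω, |x i| ≤ r) (hr0 : 0 ≤ r) :
    IsPoincareConst Ω (2 * r) := by
  intro v
  refine H10_induction (p := fun v => ‖h1ToL2 v‖ ≤ 2 * r * ‖h1Grad v‖) ?_ (fun φ => ?_) v
  · exact isClosed_le (h1ToL2L Ω).continuous.norm (continuous_const.mul (h1GradL Ω).continuous.norm)
  have hcoord : ContDiff ℝ 1 fun x : Euc d => x i := (EuclideanSpace.proj (𝕜 := ℝ) i).contDiff
  set h : Euc d → ℝ := fun x => x i * partialDeriv i φ x with hh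
  have hmem : MemLp h 2 ((volume : Measure (Euc d)).restrict (Ω : Set (Euc d))) :=
    (hcoord.continuous.mul
      (continuous_partialDeriv (contDiff_one_test φ) i)).memLp_of_hasCompactSupport
      (hasCompactSupport_partialDeriv φ i).mul_left
  have hnorm : ‖hmem.toLp‖ ≤ r * ‖testPartial i φ‖ := by
    refine Lp.norm_le_mul_norm_of_ae_le_mul ?_
    filter_upwards [hmem.coeFn_toLp, coeFn_testPartial i φ,
      ae_restrict_mem Ω.isOpen.measurableSet] with x h1 h2 h3
    rw [h1, h2, hh, norm_mul]
    exact mul_le_mul_of_nonneg_right (hr x h3) (norm_nonneg _)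
  have hpd : ∀ x, partialDeriv i (fun x : Euc d => x i * φ x) x = φ x + h x := fun x => by
    have h1 : HasFDerivAt (fun x : Euc d => x i) (EuclideanSpace.proj (𝕜 := ℝ) i) x :=
      (EuclideanSpace.proj (𝕜 := ℝ) i).hasFDerivAt
    have h2 := ((contDiff_one_test φ).differentiable one_ne_zero x).hasFDerivAt
    have h3 : HasFDerivAt (fun x : Euc d => x i * φ x) _ x := h1.mul h2
    rw [partialDeriv, h3.fderiv]
    simp [hh, partialDeriv, add_comm]
  have hibp := setIntegral_mul_partialDeriv (hcoord.mul (contDiff_one_test φ)) i φ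
  have e1 : ∫ x in (Ω : Set (Euc d)), (x i * φ x) * partialDeriv i φ x
      = ⟪testL2 φ, hmem.toLp⟫_ℝ := by
    rw [inner_eq_integral _ _ hmem.coeFn_toLp]
    refine integral_congr_ae ?_
    filter_upwards [coeFn_testL2 φ] with x hx
    rw [hx, hh]; ring
  have e2 : ∫ x in (Ω : Set (Euc d)), partialDeriv i (fun x : Euc d => x i * φ x) x * φ x
      = ⟪testL2 φ + hmem.toLp, testL2 φ⟫_ℝ := by
    rw [inner_eq_integral _ _ (coeFn_testL2 φ)]
    refine integral_congr_ae ?_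
    filter_upwards [coeFn_testL2 φ, hmem.coeFn_toLp, Lp.coeFn_add (testL2 φ) hmem.toLp]
      with x h1 h2 h3
    rw [h3, Pi.add_apply, h1, h2, hpd]
  rw [e1, e2, inner_add_left, real_inner_self_eq_norm_sq, real_inner_comm] at hibp
  have hcs := abs_le.1 (abs_real_inner_le_norm hmem.toLp (testL2 φ))
  have hle : ‖testPartial i φ‖ ≤ ‖h1Grad (testH1 φ)‖ := PiLp.norm_apply_le (h1Grad (testH1 φ)) i
  rw [h1ToL2_testH1]
  have h0 := norm_nonneg (testL2 φ)
  have hsq : ‖testL2 φ‖ * ‖testL2 φ‖ ≤ 2 * r * ‖h1Grad (testH1 φ)‖ * ‖testL2 φ‖ := by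
    have : ‖hmem.toLp‖ * ‖testL2 φ‖ ≤ r * ‖h1Grad (testH1 φ)‖ * ‖testL2 φ‖ :=
      mul_le_mul_of_nonneg_right (hnorm.trans (mul_le_mul_of_nonneg_left hle hr0)) h0
    nlinarith [hcs.1]
  rcases h0.eq_or_lt with h0 | h0
  · rw [← h0]; positivity
  · exact le_of_mul_le_mul_right hsq h0

end sobolev
/-! ### Polynomials as functions on `ℝ^d` and as Sobolev functions on a ball -/

section polynomials

open MvPolynomial (pderiv)

variable {d : ℕ}

/-- Polynomials in `d` variables, as continuous functions on `ℝ^d`. -/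
noncomputable def evalC (d : ℕ) : MvPolynomial (Fin d) ℝ →ₐ[ℝ] C(Euc d, ℝ) :=
  MvPolynomial.aeval fun i => ⟨fun x : Euc d => x i, (EuclideanSpace.proj (𝕜 := ℝ) i).continuous⟩

theorem evalC_apply (q : MvPolynomial (Fin d) ℝ) (x : Euc d) :
    evalC d q x = MvPolynomial.eval x.ofLp q := by
  induction q using MvPolynomial.induction_on with
  | C a => simp [evalC, algebraMap_apply]
  | add p q hp hq => simp [hp, hq]
  | mul_X p i hp =>
    rw [map_mul, ContinuousMap.mul_apply, hp, map_mul, MvPolynomial.eval_X, evalC,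
      MvPolynomial.aeval_X]
    rfl

@[simp] theorem evalC_C (a : ℝ) (x : Euc d) : evalC d (MvPolynomial.C a) x = a := by
  rw [evalC_apply, MvPolynomial.eval_C]

@[simp] theorem evalC_X (i : Fin d) (x : Euc d) : evalC d (MvPolynomial.X i) x = x i := by
  simp [evalC_apply]

theorem contDiff_evalC (q : MvPolynomial (Fin d) ℝ) {n : WithTop ℕ∞} :
    ContDiff ℝ n (evalC d q) := by
  induction q using MvPolynomial.induction_on with
  | C a =>
    have h : (evalC d (MvPolynomial.C a) : Euc d → ℝ) = fun _ => a := funext fun x => evalC_C a x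
    rw [h]; exact contDiff_const
  | add p q hp hq => rw [map_add]; exact hp.add hq
  | mul_X p i hp =>
    have h : (evalC d (MvPolynomial.X i) : Euc d → ℝ) = EuclideanSpace.proj (𝕜 := ℝ) i :=
      funext fun x => evalC_X i x
    rw [map_mul]
    refine hp.mul ?_
    rw [h]; exact (EuclideanSpace.proj (𝕜 := ℝ) i).contDiff

theorem partialDeriv_mul {f g : Euc d → ℝ} (hf : ContDiff ℝ 1 f) (hg : ContDiff ℝ 1 g)
    (i : Fin d) (x : Euc d) : partialDeriv i (fun y => f y * g y) x
      = f x * partialDeriv i g x + g x * partialDeriv i f x := by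
  have h : HasFDerivAt (fun y => f y * g y) _ x :=
    (hf.differentiable one_ne_zero x).hasFDerivAt.mul
      (hg.differentiable one_ne_zero x).hasFDerivAt
  rw [partialDeriv, h.fderiv]
  simp [partialDeriv]

theorem partialDeriv_evalC (i : Fin d) (q : MvPolynomial (Fin d) ℝ) :
    partialDeriv i (evalC d q) = evalC d (pderiv i q) := by
  induction q using MvPolynomial.induction_on with
  | C a =>
    have h : (evalC d (MvPolynomial.C a) : Euc d → ℝ) = fun _ => a := funext fun x => evalC_C a x
    ext x
    rw [partialDeriv, h]; simp
  | add p q hp hq =>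
    ext x
    have hp' := (contDiff_evalC p (n := 1)).differentiable one_ne_zero x
    have hq' := (contDiff_evalC q (n := 1)).differentiable one_ne_zero x
    have h : HasFDerivAt (evalC d (p + q))
        (fderiv ℝ (evalC d p) x + fderiv ℝ (evalC d q) x) x := by
      rw [map_add]; exact hp'.hasFDerivAt.add hq'.hasFDerivAt
    rw [partialDeriv, h.fderiv, map_add, map_add, ContinuousMap.add_apply, ← hp, ← hq]
    rfl
  | mul_X p j hp =>
    ext x
    have hX : partialDeriv i (evalC d (MvPolynomial.X j)) x
        = evalC d (pderiv i (MvPolynomial.X j)) x := by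
      have h : (evalC d (MvPolynomial.X j) : Euc d → ℝ) = EuclideanSpace.proj (𝕜 := ℝ) j :=
        funext fun x => evalC_X j x
      rw [partialDeriv, h, ContinuousLinearMap.fderiv, MvPolynomial.pderiv_X]
      rcases eq_or_ne i j with rfl | hij
      · simp
      · simp [Ne.symm hij]
    have h : (evalC d (p * MvPolynomial.X j) : Euc d → ℝ)
        = fun y => evalC d p y * evalC d (MvPolynomial.X j) y := by rw [map_mul]; rfl
    rw [h, partialDeriv_mul (contDiff_evalC p) (contDiff_evalC _), hp, hX, MvPolynomial.pderiv_mul,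
      map_add, map_mul, map_mul]
    simp only [ContinuousMap.add_apply, ContinuousMap.mul_apply]
    ring

theorem pderiv_comm (i j : Fin d) (q : MvPolynomial (Fin d) ℝ) :
    pderiv i (pderiv j q) = pderiv j (pderiv i q) := by
  have h : ⁅pderiv (R := ℝ) i, pderiv (R := ℝ) j⁆ = 0 := by
    refine MvPolynomial.derivation_ext fun k => ?_
    rw [Derivation.commutator_apply, MvPolynomial.pderiv_X, MvPolynomial.pderiv_X]
    have : ∀ a b c : Fin d,
        pderiv (R := ℝ) a (Pi.single (M := fun _ => MvPolynomial (Fin d) ℝ) b 1 c) = 0 := by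
      intro a b c
      rcases eq_or_ne c b with rfl | h
      · simp
      · simp [h]
    rw [this, this, sub_zero]; rfl
  have h2 := DFunLike.congr_fun h q
  rw [Derivation.commutator_apply] at h2
  exact sub_eq_zero.1 h2

theorem totalDegree_pderiv_le (i : Fin d) {q : MvPolynomial (Fin d) ℝ} {m : ℕ}
    (hq : q.totalDegree ≤ m + 1) : (pderiv i q).totalDegree ≤ m := by
  rw [q.as_sum, map_sum]
  refine MvPolynomial.totalDegree_finsetSum_le fun s hs => ?_
  rw [MvPolynomial.pderiv_monomial]
  rcases eq_or_ne (s i) 0 with h0 | h0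
  · simp [h0]
  · refine (MvPolynomial.totalDegree_monomial_le _ _).trans ?_
    have h1 : (s.sum fun _ e => e) ≤ m + 1 := (MvPolynomial.le_totalDegree hs).trans hq
    have hle : Finsupp.single i 1 ≤ s := by
      rw [Finsupp.single_le_iff]; omega
    have h2 : (s.sum fun _ e => e) = ((s - Finsupp.single i 1).sum fun _ e => e) + 1 := by
      conv_lhs => rw [← tsub_add_cancel_of_le hle]
      rw [Finsupp.sum_add_index' (fun _ => rfl) (fun _ _ _ => rfl), Finsupp.sum_single_index rfl]
    change ((s - Finsupp.single i 1).sum fun _ e => e) ≤ m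
    omega

/-- The polynomial `ρ² - |x|²`, which vanishes on the sphere of radius `ρ`. -/
noncomputable def ballPoly (d : ℕ) (ρ : ℝ) : MvPolynomial (Fin d) ℝ :=
  MvPolynomial.C (ρ ^ 2) - ∑ i, MvPolynomial.X i ^ 2

@[simp] theorem evalC_ballPoly (ρ : ℝ) (x : Euc d) :
    evalC d (ballPoly d ρ) x = ρ ^ 2 - ‖x‖ ^ 2 := by
  rw [EuclideanSpace.real_norm_sq_eq, evalC_apply, ballPoly]
  simp

@[simp] theorem pderiv_ballPoly (ρ : ℝ) (i : Fin d) :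
    pderiv i (ballPoly d ρ) = -2 * MvPolynomial.X i := by
  have h : ∀ j, pderiv i ((MvPolynomial.X j : MvPolynomial (Fin d) ℝ) ^ 2)
      = if j = i then 2 * MvPolynomial.X i else 0 := fun j => by
    rw [MvPolynomial.pderiv_pow, MvPolynomial.pderiv_X]
    rcases eq_or_ne j i with rfl | hij
    · simp
    · simp [hij]
  rw [ballPoly, map_sub, map_sum, MvPolynomial.pderiv_C, Finset.sum_congr rfl fun j _ => h j]
  simp

theorem totalDegree_ballPoly_le (ρ : ℝ) : (ballPoly d ρ).totalDegree ≤ 2 := by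
  refine (MvPolynomial.totalDegree_sub _ _).trans
    (max_le (by rw [MvPolynomial.totalDegree_C]; omega) ?_)
  exact MvPolynomial.totalDegree_finsetSum_le fun i _ => by simp

/-- The formal Laplacian of a polynomial. -/
noncomputable def polyLaplacian (d : ℕ) : MvPolynomial (Fin d) ℝ →ₗ[ℝ] MvPolynomial (Fin d) ℝ :=
  ∑ i, (pderiv i).toLinearMap ∘ₗ (pderiv i).toLinearMap

theorem polyLaplacian_apply (q : MvPolynomial (Fin d) ℝ) :
    polyLaplacian d q = ∑ i, pderiv i (pderiv i q) := by
  simp [polyLaplacian]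

theorem mem_originBall {ρ : ℝ} {x : Euc d} : x ∈ originBall d ρ ↔ ‖x‖ < ρ := mem_ball_zero_iff

theorem ballPoly_pos {ρ : ℝ} {x : Euc d} (hx : x ∈ originBall d ρ) : 0 < ρ ^ 2 - ‖x‖ ^ 2 := by
  have := mem_originBall.1 hx
  nlinarith [norm_nonneg x]

theorem exists_bound_originBall (ρ : ℝ) {f : Euc d → ℝ} (hf : Continuous f) :
    ∃ C, 0 ≤ C ∧ ∀ x ∈ originBall d ρ, |f x| ≤ C := by
  obtain ⟨C, hC⟩ :=
    (isCompact_closedBall (0 : Euc d) ρ).exists_bound_of_continuousOn hf.continuousOn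
  exact ⟨|C|, abs_nonneg C, fun x hx =>
    (hC x (Metric.ball_subset_closedBall hx)).trans (le_abs_self C)⟩

instance isFiniteMeasure_originBall (ρ : ℝ) :
    IsFiniteMeasure ((volume : Measure (Euc d)).restrict (originBall d ρ : Set (Euc d))) :=
  isFiniteMeasure_restrict.2 measure_ball_lt_top.ne

theorem memLp_originBall (ρ : ℝ) (f : C(Euc d, ℝ)) :
    MemLp f 2 ((volume : Measure (Euc d)).restrict (originBall d ρ : Set (Euc d))) := by
  obtain ⟨C, -, hC⟩ := exists_bound_originBall ρ f.continuous
  refine MemLp.of_bound f.continuous.aestronglyMeasurable C ?_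
  filter_upwards [ae_restrict_mem (originBall d ρ).isOpen.measurableSet] with x hx using hC x hx

theorem integrable_originBall (ρ : ℝ) {f : Euc d → ℝ} (hf : Continuous f) :
    Integrable f ((volume : Measure (Euc d)).restrict (originBall d ρ : Set (Euc d))) :=
  (memLp_originBall ρ ⟨f, hf⟩).integrable one_le_two

/-- The class in `L²` of the ball of a polynomial. -/
noncomputable def polyL2 (d : ℕ) (ρ : ℝ) : MvPolynomial (Fin d) ℝ →ₗ[ℝ] L2 (originBall d ρ) where
  toFun q := (memLp_originBall ρ (evalC d q)).toLp
  map_add' p q := by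
    rw [← MemLp.toLp_add (memLp_originBall ρ (evalC d p)) (memLp_originBall ρ (evalC d q))]
    congr 1; rw [map_add]; rfl
  map_smul' c q := by
    rw [RingHom.id_apply, ← MemLp.toLp_const_smul _ (memLp_originBall ρ (evalC d q))]
    congr 1; rw [map_smul]; rfl

variable {ρ : ℝ}

theorem coeFn_polyL2 (q : MvPolynomial (Fin d) ℝ) :
    polyL2 d ρ q =ᵐ[(volume : Measure (Euc d)).restrict (originBall d ρ : Set (Euc d))]
      evalC d q :=
  MemLp.coeFn_toLp (memLp_originBall ρ (evalC d q))

theorem isWeakPartial_polyL2 (i : Fin d) (q : MvPolynomial (Fin d) ℝ) :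
    IsWeakPartial (originBall d ρ) i (polyL2 d ρ q) (polyL2 d ρ (pderiv i q)) :=
  isWeakPartial_of_contDiff (contDiff_evalC q) (coeFn_polyL2 q)
    ((coeFn_polyL2 _).trans (by rw [partialDeriv_evalC]))

/-- A polynomial as an element of `H¹` of the ball. -/
noncomputable def polyH1 (d : ℕ) (ρ : ℝ) : MvPolynomial (Fin d) ℝ →ₗ[ℝ] H1 (originBall d ρ) where
  toFun q := ⟨WithLp.toLp 2 (polyL2 d ρ q, WithLp.toLp 2 fun i => polyL2 d ρ (pderiv i q)),
    fun i => isWeakPartial_polyL2 i q⟩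
  map_add' p q := h1ToL2_injective (map_add (polyL2 d ρ) p q)
  map_smul' c q := h1ToL2_injective (map_smul (polyL2 d ρ) c q)

/-- A polynomial as an element of `H²` of the ball. -/
noncomputable def polyH2 (d : ℕ) (ρ : ℝ) : MvPolynomial (Fin d) ℝ →ₗ[ℝ] H2 (originBall d ρ) where
  toFun q := ⟨WithLp.toLp 2 (polyH1 d ρ q,
      WithLp.toLp 2 fun p => polyL2 d ρ (pderiv p.2 (pderiv p.1 q))),
    fun i j => isWeakPartial_polyL2 j (pderiv i q)⟩
  map_add' p q := h2ToH1_injective (map_add (polyH1 d ρ) p q)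
  map_smul' c q := h2ToH1_injective (map_smul (polyH1 d ρ) c q)

theorem h2Laplacian_polyH2 (q : MvPolynomial (Fin d) ℝ) :
    h2Laplacian (polyH2 d ρ q) = polyL2 d ρ (polyLaplacian d q) := by
  rw [polyLaplacian_apply, map_sum]; rfl

theorem inner_polyL2 (p q : MvPolynomial (Fin d) ℝ) :
    ⟪polyL2 d ρ p, polyL2 d ρ q⟫_ℝ
      = ∫ x in (originBall d ρ : Set (Euc d)), evalC d (p * q) x := by
  rw [inner_eq_integral _ _ (coeFn_polyL2 q)]
  refine integral_congr_ae ?_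
  filter_upwards [coeFn_polyL2 (ρ := ρ) p] with x hx
  rw [hx, map_mul, ContinuousMap.mul_apply]

theorem polyL2_injective (hρ : 0 < ρ) : Function.Injective (polyL2 d ρ) := by
  rw [injective_iff_map_eq_zero]
  intro q hq
  have h1 : evalC d q =ᵐ[(volume : Measure (Euc d)).restrict (originBall d ρ : Set (Euc d))]
      (0 : Euc d → ℝ) := by
    refine (coeFn_polyL2 q).symm.trans ?_
    rw [hq]
    exact Lp.coeFn_zero _ _ _
  have h2 := Measure.eqOn_open_of_ae_eq h1 (originBall d ρ).isOpen
    (evalC d q).continuous.continuousOn continuousOn_const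
  have hopen : IsOpen ((WithLp.toLp 2 : (Fin d → ℝ) → Euc d) ⁻¹' (originBall d ρ : Set (Euc d))) :=
    (originBall d ρ).isOpen.preimage (PiLp.continuous_toLp 2 _)
  obtain ⟨ε, hε, hsub⟩ := Metric.isOpen_iff.1 hopen 0 (by simpa [mem_originBall] using hρ)
  refine MvPolynomial.funext_set (fun _ => Metric.ball (0 : ℝ) ε)
    (fun _ => by rw [Real.ball_eq_Ioo]; exact Ioo_infinite (by linarith)) fun x hx => ?_
  have hx' : x ∈ Metric.ball (0 : Fin d → ℝ) ε := by rw [ball_pi _ hε]; exact hx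
  have h3 := h2 (hsub hx')
  rw [evalC_apply] at h3
  simpa using h3

/-- Polynomials are dense in `L²` of a ball, by the Stone–Weierstrass theorem. -/
theorem denseRange_polyL2 (d : ℕ) (ρ : ℝ) : DenseRange (polyL2 d ρ) := by
  set μ := (volume : Measure (Euc d)).restrict (originBall d ρ : Set (Euc d)) with hμ
  have hsep : (evalC d).range.SeparatesPoints := by
    intro x y hxy
    obtain ⟨i, hi⟩ : ∃ i, x i ≠ y i := by
      by_contra! h
      exact hxy (PiLp.ext h)
    exact ⟨_, ⟨_, ⟨MvPolynomial.X i, rfl⟩, rfl⟩, by simpa using hi⟩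
  rw [DenseRange, Metric.dense_iff]
  intro u δ hδ
  obtain ⟨g, hg⟩ := (BoundedContinuousFunction.toLp_denseRange (E := ℝ) (p := 2) μ ℝ
    ENNReal.ofNat_ne_top).exists_dist_lt u (half_pos hδ)
  set c : ℝ := (measureUnivNNReal μ : ℝ) ^ (2 : ENNReal).toReal⁻¹ with hc
  have hc0 : 0 ≤ c := by positivity
  have hη : 0 < δ / 2 / (c + 1) := by positivity
  obtain ⟨f, ⟨q, hq⟩, hf⟩ :=
    ContinuousMap.exists_mem_subalgebra_near_continuous_of_isCompact_of_separatesPoints hsep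
      g.toContinuousMap (isCompact_closedBall (0 : Euc d) ρ) hη
  refine ⟨polyL2 d ρ q, ?_, mem_range_self q⟩
  have h1 : ‖polyL2 d ρ q - BoundedContinuousFunction.toLp 2 μ ℝ g‖ ≤ c * (δ / 2 / (c + 1)) := by
    refine Lp.norm_le_of_ae_bound (by positivity) ?_
    filter_upwards [coeFn_polyL2 q, BoundedContinuousFunction.coeFn_toLp (p := 2) μ ℝ g,
      Lp.coeFn_sub (polyL2 d ρ q) (BoundedContinuousFunction.toLp 2 μ ℝ g),
      ae_restrict_mem (originBall d ρ).isOpen.measurableSet] with x e1 e2 e3 hx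
    rw [e3, Pi.sub_apply, e1, e2]
    have h4 := hf x (Metric.ball_subset_closedBall hx)
    rw [← hq] at h4
    exact h4.le
  have h2 : c * (δ / 2 / (c + 1)) ≤ δ / 2 := by
    rw [mul_div_assoc', div_le_iff₀ (by positivity)]
    nlinarith
  rw [Metric.mem_ball, dist_comm]
  refine (dist_triangle _ _ _).trans_lt (by
    rw [dist_comm (BoundedContinuousFunction.toLp 2 μ ℝ g), dist_eq_norm (polyL2 d ρ q)]; linarith)

end polynomials
/-! ### Cut-off functions and the divergence inequality on a ball -/

section cutoff

open MvPolynomial (pderiv)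

variable {d : ℕ} {ρ : ℝ}

theorem deriv_smoothTransition_eq_zero {t : ℝ} (ht : 1 < t) :
    deriv Real.smoothTransition t = 0 := by
  have h : Real.smoothTransition =ᶠ[𝓝 t] fun _ => 1 := by
    filter_upwards [lt_mem_nhds ht] with s hs using Real.smoothTransition.one_of_one_le hs.le
  rw [h.deriv_eq, deriv_const]

theorem continuous_deriv_smoothTransition : Continuous (deriv Real.smoothTransition) :=
  (Real.smoothTransition.contDiff (n := 1)).continuous_deriv le_rfl

theorem deriv_smoothTransition_nonneg (t : ℝ) : 0 ≤ deriv Real.smoothTransition t :=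
  Real.smoothTransition.monotone.deriv_nonneg

theorem exists_bound_deriv_smoothTransition :
    ∃ M, 0 ≤ M ∧ ∀ t, -1 ≤ t → |deriv Real.smoothTransition t| ≤ M := by
  obtain ⟨C, hC⟩ := (isCompact_Icc (a := (-1 : ℝ)) (b := 1)).exists_bound_of_continuousOn
    continuous_deriv_smoothTransition.continuousOn
  refine ⟨|C|, abs_nonneg C, fun t ht => ?_⟩
  rcases le_or_gt t 1 with h | h
  · exact (hC t ⟨ht, h⟩).trans (le_abs_self C)
  · rw [deriv_smoothTransition_eq_zero h, abs_zero]; exact abs_nonneg C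

/-- The quantity `(n + 1) (ρ² - |x|²) - 1`, on which the cut-off functions depend. -/
noncomputable def cutoffArg (d : ℕ) (ρ : ℝ) (n : ℕ) (x : Euc d) : ℝ :=
  ((n : ℝ) + 1) * (ρ ^ 2 - ‖x‖ ^ 2) - 1

theorem contDiff_cutoffArg (n : ℕ) {k : WithTop ℕ∞} : ContDiff ℝ k (cutoffArg d ρ n) :=
  (contDiff_const.mul (contDiff_const.sub (contDiff_norm_sq ℝ))).sub contDiff_const

/-- Test functions on the ball, with values in `[0, 1]`, that increase to `1`: they vanish where
`ρ² - |x|² ≤ 1 / (n + 1)` and equal `1` where `ρ² - |x|² ≥ 2 / (n + 1)`. -/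
noncomputable def cutoff (d : ℕ) (ρ : ℝ) (hρ : 0 < ρ) (n : ℕ) : 𝓓(originBall d ρ, ℝ) :=
  have hsub : tsupport (fun x => Real.smoothTransition (cutoffArg d ρ n x))
      ⊆ {x | 0 ≤ cutoffArg d ρ n x} := by
    refine closure_minimal (fun x hx => ?_)
      (isClosed_le continuous_const (contDiff_cutoffArg n (k := 0)).continuous)
    by_contra h
    exact hx (Real.smoothTransition.zero_of_nonpos (not_le.1 h).le)
  have hball : {x | 0 ≤ cutoffArg d ρ n x} ⊆ originBall d ρ := by
    intro x hx
    refine mem_originBall.2 ?_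
    have h1 : 0 ≤ ((n : ℝ) + 1) * (ρ ^ 2 - ‖x‖ ^ 2) - 1 := hx
    have h2 : 0 < ρ ^ 2 - ‖x‖ ^ 2 := by
      by_contra h
      nlinarith [mul_nonneg (by positivity : (0 : ℝ) ≤ (n : ℝ) + 1) (neg_nonneg.2 (not_lt.1 h))]
    exact lt_of_pow_lt_pow_left₀ 2 hρ.le (by linarith)
  { toFun := fun x => Real.smoothTransition (cutoffArg d ρ n x)
    contDiff' := Real.smoothTransition.contDiff.comp (contDiff_cutoffArg n)
    hasCompactSupport' := (isCompact_closedBall (0 : Euc d) ρ).of_isClosed_subset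
      (isClosed_tsupport _) ((hsub.trans hball).trans Metric.ball_subset_closedBall)
    tsupport_subset' := hsub.trans hball }

theorem cutoff_apply (hρ : 0 < ρ) (n : ℕ) (x : Euc d) :
    cutoff d ρ hρ n x = Real.smoothTransition (cutoffArg d ρ n x) := rfl

/-- The nonnegative weight for which `∇ cutoff = -2 x * cutoffWeight`. -/
noncomputable def cutoffWeight (d : ℕ) (ρ : ℝ) (n : ℕ) (x : Euc d) : ℝ :=
  ((n : ℝ) + 1) * deriv Real.smoothTransition (cutoffArg d ρ n x)

theorem continuous_cutoffWeight (n : ℕ) : Continuous (cutoffWeight d ρ n) :=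
  continuous_const.mul
    (continuous_deriv_smoothTransition.comp (contDiff_cutoffArg n (k := 0)).continuous)

theorem cutoffWeight_nonneg (n : ℕ) (x : Euc d) : 0 ≤ cutoffWeight d ρ n x :=
  mul_nonneg (by positivity) (deriv_smoothTransition_nonneg _)

theorem partialDeriv_cutoff (hρ : 0 < ρ) (n : ℕ) (i : Fin d) (x : Euc d) :
    partialDeriv i (cutoff d ρ hρ n) x = -2 * x i * cutoffWeight d ρ n x := by
  have h1 : HasFDerivAt (cutoffArg d ρ n)
      (((n : ℝ) + 1) • -((2 : ℕ) • innerSL ℝ x) : Euc d →L[ℝ] ℝ) x := by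
    have h := (((hasStrictFDerivAt_norm_sq x).hasFDerivAt.const_sub (ρ ^ 2)).const_mul
      ((n : ℝ) + 1)).sub_const 1
    exact h
  have h2 : HasDerivAt Real.smoothTransition (deriv Real.smoothTransition (cutoffArg d ρ n x))
      (cutoffArg d ρ n x) :=
    ((Real.smoothTransition.contDiff (n := 1)).differentiable one_ne_zero _).hasDerivAt
  have h3 : HasFDerivAt (cutoff d ρ hρ n) _ x := h2.comp_hasFDerivAt x h1
  rw [partialDeriv, h3.fderiv, cutoffWeight]
  simp [EuclideanSpace.inner_single_right]
  ring

theorem eventually_lt_cutoffArg {x : Euc d} (hx : x ∈ originBall d ρ) :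
    ∀ᶠ n : ℕ in atTop, 1 < cutoffArg d ρ n x := by
  have hp := ballPoly_pos hx
  obtain ⟨N, hN⟩ := exists_nat_gt (2 / (ρ ^ 2 - ‖x‖ ^ 2))
  filter_upwards [eventually_ge_atTop N] with n hn
  have h1 : (N : ℝ) ≤ n := by exact_mod_cast hn
  rw [div_lt_iff₀ hp] at hN
  rw [cutoffArg]
  nlinarith

theorem eventually_cutoff_eq_one (hρ : 0 < ρ) {x : Euc d} (hx : x ∈ originBall d ρ) :
    ∀ᶠ n : ℕ in atTop, cutoff d ρ hρ n x = 1 :=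
  (eventually_lt_cutoffArg hx).mono fun _ hn => Real.smoothTransition.one_of_one_le hn.le

theorem eventually_cutoffWeight_eq_zero {x : Euc d} (hx : x ∈ originBall d ρ) :
    ∀ᶠ n : ℕ in atTop, cutoffWeight d ρ n x = 0 :=
  (eventually_lt_cutoffArg hx).mono fun n hn => by
    rw [cutoffWeight, deriv_smoothTransition_eq_zero hn, mul_zero]

theorem abs_cutoff_le_one (hρ : 0 < ρ) (n : ℕ) (x : Euc d) : |cutoff d ρ hρ n x| ≤ 1 := by
  rw [cutoff_apply, abs_of_nonneg (Real.smoothTransition.nonneg _)]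
  exact Real.smoothTransition.le_one _

/-- The gradients of the cut-off functions blow up no faster than the inverse of
`ρ² - |x|²`. -/
theorem exists_bound_cutoffWeight (d : ℕ) (ρ : ℝ) :
    ∃ M, 0 ≤ M ∧ ∀ n, ∀ x ∈ originBall d ρ, |(ρ ^ 2 - ‖x‖ ^ 2) * cutoffWeight d ρ n x| ≤ M := by
  obtain ⟨M, hM0, hM⟩ := exists_bound_deriv_smoothTransition
  refine ⟨2 * M, by positivity, fun n x hx => ?_⟩
  have hp := ballPoly_pos hx
  have hpos : 0 < ((n : ℝ) + 1) * (ρ ^ 2 - ‖x‖ ^ 2) := by positivity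
  have h1 : (ρ ^ 2 - ‖x‖ ^ 2) * cutoffWeight d ρ n x = ((n : ℝ) + 1) * (ρ ^ 2 - ‖x‖ ^ 2)
      * deriv Real.smoothTransition (cutoffArg d ρ n x) := by rw [cutoffWeight]; ring
  rw [h1]
  rcases le_or_gt (cutoffArg d ρ n x) 1 with h | h
  · rw [abs_mul, abs_of_pos hpos]
    refine mul_le_mul ?_ (hM _ ?_) (abs_nonneg _) zero_le_two
    · rw [cutoffArg] at h; linarith
    · rw [cutoffArg]; linarith
  · rw [deriv_smoothTransition_eq_zero h, mul_zero, abs_zero]; positivity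

theorem tendsto_setIntegral_cutoff_mul (hρ : 0 < ρ) {g : Euc d → ℝ} (hg : Continuous g) :
    Tendsto (fun n => ∫ x in (originBall d ρ : Set (Euc d)), g x * cutoff d ρ hρ n x) atTop
      (𝓝 (∫ x in (originBall d ρ : Set (Euc d)), g x)) := by
  refine tendsto_integral_of_dominated_convergence (fun x => |g x|)
    (fun n => (hg.mul (cutoff d ρ hρ n).continuous).aestronglyMeasurable)
    (integrable_originBall ρ hg.abs) (fun n => Eventually.of_forall fun x => ?_) ?_
  · rw [Real.norm_eq_abs, abs_mul]
    exact mul_le_of_le_one_right (abs_nonneg _) (abs_cutoff_le_one hρ n x)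
  · filter_upwards [ae_restrict_mem (originBall d ρ).isOpen.measurableSet] with x hx
    refine tendsto_const_nhds.congr' ?_
    filter_upwards [eventually_cutoff_eq_one hρ hx] with n hn
    rw [hn, mul_one]

theorem tendsto_setIntegral_cutoffWeight_mul {g : Euc d → ℝ} (hg : Continuous g) :
    Tendsto (fun n => ∫ x in (originBall d ρ : Set (Euc d)),
      (ρ ^ 2 - ‖x‖ ^ 2) * cutoffWeight d ρ n x * g x) atTop (𝓝 0) := by
  obtain ⟨M, hM0, hM⟩ := exists_bound_cutoffWeight d ρ
  rw [← integral_zero (Euc d) ℝ (μ := volume.restrict (originBall d ρ : Set (Euc d)))]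
  refine tendsto_integral_of_dominated_convergence (fun x => M * |g x|)
    (fun n => ?_) ((integrable_originBall ρ hg.abs).const_mul M) (fun n => ?_) ?_
  · exact (((continuous_const.sub (continuous_norm.pow 2)).mul
      (continuous_cutoffWeight n)).mul hg).aestronglyMeasurable
  · filter_upwards [ae_restrict_mem (originBall d ρ).isOpen.measurableSet] with x hx
    rw [Real.norm_eq_abs, abs_mul]
    exact mul_le_mul_of_nonneg_right (hM n x hx) (abs_nonneg _)
  · filter_upwards [ae_restrict_mem (originBall d ρ).isOpen.measurableSet] with x hx
    refine tendsto_const_nhds.congr' ?_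
    filter_upwards [eventually_cutoffWeight_eq_zero hx] with n hn
    rw [hn, mul_zero, zero_mul]

/-- If a polynomial vector field `F` points outwards on the sphere (`F · x ≥ 0` there, written as
`F · x = a + (ρ² - |x|²) s` with `a ≥ 0`), then `∫ div F ≥ 0` over the ball. It stands in for the
divergence theorem with its boundary integral. -/
theorem setIntegral_divergence_nonneg (hρ : 0 < ρ) {F : Fin d → MvPolynomial (Fin d) ℝ}
    {a s : MvPolynomial (Fin d) ℝ} (ha : ∀ x ∈ originBall d ρ, 0 ≤ evalC d a x)
    (hF : ∑ i, F i * MvPolynomial.X i = a + ballPoly d ρ * s) :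
    0 ≤ ∫ x in (originBall d ρ : Set (Euc d)), evalC d (∑ i, pderiv i (F i)) x := by
  refine le_of_tendsto_of_tendsto' ((tendsto_setIntegral_cutoffWeight_mul
    (d := d) (ρ := ρ) (evalC d s).continuous).const_mul 2 |>.trans_eq (by rw [mul_zero]))
    (tendsto_setIntegral_cutoff_mul hρ (evalC d _).continuous) fun n => ?_
  have hint : ∀ g : Euc d → ℝ, Continuous g → Integrable g
      ((volume : Measure (Euc d)).restrict (originBall d ρ : Set (Euc d))) :=
    fun g hg => integrable_originBall ρ hg
  have h1 : ∀ i, ∫ x in (originBall d ρ : Set (Euc d)),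
      evalC d (pderiv i (F i)) x * cutoff d ρ hρ n x
        = ∫ x in (originBall d ρ : Set (Euc d)),
          2 * (cutoffWeight d ρ n x * (evalC d (F i) x * x i)) := fun i => by
    have h := setIntegral_mul_partialDeriv (contDiff_evalC (F i)) i (cutoff d ρ hρ n)
    rw [partialDeriv_evalC] at h
    rw [← neg_eq_iff_eq_neg.2 h, ← integral_neg]
    refine integral_congr_ae (Eventually.of_forall fun x => ?_)
    simp only [partialDeriv_cutoff]
    ring
  have hcoord : ∀ i : Fin d, Continuous fun x : Euc d => x i := fun i =>
    (EuclideanSpace.proj (𝕜 := ℝ) i).continuous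
  have h2 : ∫ x in (originBall d ρ : Set (Euc d)),
      evalC d (∑ i, pderiv i (F i)) x * cutoff d ρ hρ n x
        = ∫ x in (originBall d ρ : Set (Euc d)),
          2 * (cutoffWeight d ρ n x * evalC d (a + ballPoly d ρ * s) x) := by
    rw [← hF]
    simp only [map_sum, map_mul, ContinuousMap.sum_apply, ContinuousMap.mul_apply, evalC_X,
      Finset.sum_mul, Finset.mul_sum]
    rw [integral_finsetSum, integral_finsetSum]
    · exact Finset.sum_congr rfl fun i _ => h1 i
    · exact fun i _ => hint _ (continuous_const.mul ((continuous_cutoffWeight n).mul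
        ((evalC d (F i)).continuous.mul (hcoord i))))
    · exact fun i _ => hint _ ((evalC d _).continuous.mul (cutoff d ρ hρ n).continuous)
  rw [h2, ← integral_const_mul]
  refine integral_mono_ae (hint _ ?_) (hint _ ?_) ?_
  · exact continuous_const.mul (((continuous_const.sub (continuous_norm.pow 2)).mul
      (continuous_cutoffWeight n)).mul (evalC d s).continuous)
  · exact continuous_const.mul ((continuous_cutoffWeight n).mul (evalC d _).continuous)
  · filter_upwards [ae_restrict_mem (originBall d ρ).isOpen.measurableSet] with x hx
    rw [map_add, map_mul, ContinuousMap.add_apply, ContinuousMap.mul_apply, evalC_ballPoly]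
    have := mul_nonneg (cutoffWeight_nonneg (ρ := ρ) n x) (ha x hx)
    nlinarith

/-- Bounded pointwise convergence on a ball implies convergence in `L²`. -/
theorem tendsto_L2_of_bounded {u : ℕ → L2 (originBall d ρ)} {v : L2 (originBall d ρ)}
    {f : ℕ → Euc d → ℝ} {g : Euc d → ℝ} {B : ℝ}
    (hu : ∀ n, u n =ᵐ[(volume : Measure (Euc d)).restrict (originBall d ρ : Set (Euc d))] f n)
    (hv : v =ᵐ[(volume : Measure (Euc d)).restrict (originBall d ρ : Set (Euc d))] g)
    (hB : ∀ n, ∀ x ∈ originBall d ρ, |f n x - g x| ≤ B)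
    (hlim : ∀ x ∈ originBall d ρ, Tendsto (fun n => f n x) atTop (𝓝 (g x))) :
    Tendsto u atTop (𝓝 v) := by
  set μ := (volume : Measure (Euc d)).restrict (originBall d ρ : Set (Euc d))
  have hsub : ∀ n, (u n - v : L2 (originBall d ρ)) =ᵐ[μ] fun x => f n x - g x := fun n => by
    filter_upwards [Lp.coeFn_sub (u n) v, hu n, hv] with x h1 h2 h3
    rw [h1, Pi.sub_apply, h2, h3]
  have hmem := ae_restrict_mem (μ := (volume : Measure (Euc d)))
    (originBall d ρ).isOpen.measurableSet
  have h1 : Tendsto (fun n => ‖u n - v‖ ^ 2) atTop (𝓝 0) := by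
    have h2 : ∀ n, ‖u n - v‖ ^ 2 = ∫ x, (u n - v : L2 (originBall d ρ)) x * (f n x - g x) ∂μ :=
      fun n => by rw [← real_inner_self_eq_norm_sq, inner_eq_integral _ _ (hsub n)]
    simp_rw [h2]
    rw [← integral_zero (Euc d) ℝ (μ := μ)]
    refine tendsto_integral_of_dominated_convergence (fun _ => B * B) (fun n => ?_)
      (integrable_const _) (fun n => ?_) ?_
    · exact (Lp.aestronglyMeasurable _).mul ((Lp.aestronglyMeasurable _).congr (hsub n))
    · filter_upwards [hsub n, hmem] with x hx hm
      rw [hx, norm_mul]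
      exact mul_le_mul (hB n x hm) (hB n x hm) (norm_nonneg _) ((abs_nonneg _).trans (hB n x hm))
    · filter_upwards [ae_all_iff.2 hsub, hmem] with x hx hm
      simp_rw [hx]
      have h3 := (hlim x hm).sub_const (g x)
      rw [sub_self] at h3
      simpa using h3.mul h3
  rw [tendsto_iff_norm_sub_tendsto_zero]
  have h2 := h1.sqrt
  simpa [Real.sqrt_sq] using h2

/-- A polynomial that vanishes on the sphere belongs to `H¹₀` of the ball. -/
theorem polyH1_ballPoly_mul_mem (hρ : 0 < ρ) (q : MvPolynomial (Fin d) ℝ) :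
    polyH1 d ρ (ballPoly d ρ * q) ∈ H10 (originBall d ρ) := by
  set u := ballPoly d ρ * q with hu
  let φ : ℕ → 𝓓(originBall d ρ, ℝ) := fun n =>
    { toFun := fun x => cutoff d ρ hρ n x * evalC d u x
      contDiff' := (cutoff d ρ hρ n).contDiff.mul (contDiff_evalC u)
      hasCompactSupport' := (cutoff d ρ hρ n).hasCompactSupport.mul_right
      tsupport_subset' := (tsupport_mul_subset_left).trans (cutoff d ρ hρ n).tsupport_subset }
  have hφ : ∀ n x, φ n x = cutoff d ρ hρ n x * evalC d u x := fun _ _ => rfl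
  have hφ' : ∀ n i x, partialDeriv i (φ n) x = cutoff d ρ hρ n x * evalC d (pderiv i u) x
      - ((ρ ^ 2 - ‖x‖ ^ 2) * cutoffWeight d ρ n x) * (2 * x i * evalC d q x) := fun n i x => by
    have h := partialDeriv_mul (contDiff_one_test (cutoff d ρ hρ n)) (contDiff_evalC u) i x
    rw [partialDeriv_evalC, partialDeriv_cutoff] at h
    refine h.trans ?_
    rw [hu, map_mul (evalC d) (ballPoly d ρ) q, ContinuousMap.mul_apply, evalC_ballPoly]
    ring
  have h0 : Tendsto (fun n => testL2 (φ n)) atTop (𝓝 (polyL2 d ρ u)) := by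
    obtain ⟨C, hC0, hC⟩ := exists_bound_originBall ρ (evalC d u).continuous
    refine tendsto_L2_of_bounded (B := C + C) (fun n => coeFn_testL2 (φ n)) (coeFn_polyL2 u)
      (fun n x hx => ?_) fun x hx => ?_
    · refine (abs_sub _ _).trans (add_le_add ?_ (hC x hx))
      rw [hφ, abs_mul]
      exact (mul_le_of_le_one_left (abs_nonneg _) (abs_cutoff_le_one hρ n x)).trans (hC x hx)
    · refine tendsto_const_nhds.congr' ?_
      filter_upwards [eventually_cutoff_eq_one hρ hx] with n hn
      rw [hφ, hn, one_mul]
  have h1 : ∀ i, Tendsto (fun n => testPartial i (φ n)) atTop (𝓝 (polyL2 d ρ (pderiv i u))) := by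
    intro i
    obtain ⟨C, hC0, hC⟩ := exists_bound_originBall ρ (evalC d (pderiv i u)).continuous
    have hcoord : Continuous fun x : Euc d => x i := (EuclideanSpace.proj (𝕜 := ℝ) i).continuous
    obtain ⟨D, hD0, hD⟩ := exists_bound_originBall ρ
      ((continuous_const.mul hcoord).mul (evalC d q).continuous : Continuous fun x : Euc d =>
        2 * x i * evalC d q x)
    obtain ⟨M, hM0, hM⟩ := exists_bound_cutoffWeight d ρ
    refine tendsto_L2_of_bounded (B := C + M * D + C) (fun n => coeFn_testPartial i (φ n))
      (coeFn_polyL2 _) (fun n x hx => ?_) fun x hx => ?_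
    · refine (abs_sub _ _).trans (add_le_add ?_ (hC x hx))
      rw [hφ']
      refine (abs_sub _ _).trans (add_le_add ?_ ?_)
      · rw [abs_mul]
        exact (mul_le_of_le_one_left (abs_nonneg _) (abs_cutoff_le_one hρ n x)).trans (hC x hx)
      · rw [abs_mul]
        exact mul_le_mul (hM n x hx) (hD x hx) (abs_nonneg _) hM0
    · refine tendsto_const_nhds.congr' ?_
      filter_upwards [eventually_cutoff_eq_one hρ hx, eventually_cutoffWeight_eq_zero hx]
        with n hn hn'
      rw [hφ', hn, hn', one_mul, mul_zero, zero_mul, sub_zero]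
  have hlim : Tendsto (fun n => testH1 (φ n)) atTop (𝓝 (polyH1 d ρ u)) := by
    rw [tendsto_subtype_rng]
    refine ((WithLp.prod_continuous_toLp 2 _ _).tendsto _).comp (h0.prodMk_nhds ?_)
    exact ((PiLp.continuous_toLp 2 _).tendsto _).comp (tendsto_pi_nhds.2 h1)
  exact (Submodule.isClosed_topologicalClosure _).mem_of_tendsto hlim
    (Eventually.of_forall fun n => testH1_mem_H10 (φ n))

end cutoff
/-! ### Elliptic regularity for the Dirichlet problem on a ball -/

section regularity

open MvPolynomial (pderiv)

variable {d : ℕ} {ρ : ℝ}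

/-- The vector field `F = Δu ∇u - D²u ∇u`, with `div F = (Δu)² - |D²u|²`. -/
noncomputable def hessField (u : MvPolynomial (Fin d) ℝ) (j : Fin d) : MvPolynomial (Fin d) ℝ :=
  ∑ i, (pderiv i (pderiv i u) * pderiv j u - pderiv j (pderiv i u) * pderiv i u)

theorem sum_pderiv_hessField (u : MvPolynomial (Fin d) ℝ) :
    ∑ j, pderiv j (hessField u j)
      = polyLaplacian d u * polyLaplacian d u
        - ∑ p : Fin d × Fin d, pderiv p.2 (pderiv p.1 u) * pderiv p.2 (pderiv p.1 u) := by
  let A : Fin d → Fin d → MvPolynomial (Fin d) ℝ := fun j i =>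
    pderiv j (pderiv i (pderiv i u)) * pderiv j u
  let B : Fin d → Fin d → MvPolynomial (Fin d) ℝ := fun j i =>
    pderiv i (pderiv i u) * pderiv j (pderiv j u)
  let H : Fin d → Fin d → MvPolynomial (Fin d) ℝ := fun j i =>
    pderiv j (pderiv i u) * pderiv j (pderiv i u)
  have h1 : ∀ j, pderiv j (hessField u j) = ∑ i, ((A j i - A i j) + (B j i - H j i)) := fun j => by
    rw [hessField, map_sum]
    refine Finset.sum_congr rfl fun i _ => ?_
    rw [map_sub, MvPolynomial.pderiv_mul, MvPolynomial.pderiv_mul, pderiv_comm j i u,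
      pderiv_comm j i (pderiv j u)]
    simp only [A, B, H]
    rw [pderiv_comm j i u]
    ring
  have h2 : polyLaplacian d u * polyLaplacian d u = ∑ j, ∑ i, B j i := by
    rw [polyLaplacian_apply, Finset.sum_mul_sum, Finset.sum_comm]
  have h3 : ∑ p : Fin d × Fin d, pderiv p.2 (pderiv p.1 u) * pderiv p.2 (pderiv p.1 u)
      = ∑ j, ∑ i, H j i := by
    rw [Fintype.sum_prod_type, Finset.sum_comm]
  rw [Finset.sum_congr rfl fun j _ => h1 j, h2, h3]
  simp only [Finset.sum_add_distrib, Finset.sum_sub_distrib]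
  rw [Finset.sum_comm (f := A), sub_self, zero_add]

/-- The value of `F · x` for `F = hessField ((ρ² - |x|²) q)` in a ring in which `ρ² - |x|² = 0`.
Here `Q`, `D`, `g`, `h` stand for `q`, `∇q` and the first and second derivatives of
`(ρ² - |x|²) q`. All terms with derivatives of `q` cancel. -/
theorem sum_hess_sub_mul_eq {A : Type*} [CommRing A] (x D : Fin d → A) (Q : A)
    {g : Fin d → A} {h : Fin d → Fin d → A} (hg : ∀ i, g i = -2 * x i * Q)
    (hh : ∀ i j, h i j = -2 * (if i = j then 1 else 0) * Q - 2 * x i * D j - 2 * x j * D i) :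
    ∑ j, (∑ i, (h i i * g j - h i j * g i)) * x j
      = 4 * ((d : A) - 1) * (∑ i, x i ^ 2) * Q ^ 2 := by
  set N := ∑ i, x i ^ 2 with hN
  set E := ∑ i, x i * D i with hE
  have e1 : ∑ i, h i i = -2 * d * Q - 4 * E := by
    have : ∀ i, h i i = -2 * Q - 4 * (x i * D i) := fun i => by rw [hh, if_pos rfl]; ring
    rw [Finset.sum_congr rfl fun i _ => this i, Finset.sum_sub_distrib, Finset.sum_const,
      Finset.card_univ, Fintype.card_fin, nsmul_eq_mul, ← Finset.mul_sum]
    ring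
  have e2 : ∀ j, ∑ i, h i j * g i = 4 * x j * Q ^ 2 + 4 * Q * D j * N + 4 * Q * E * x j := by
    intro j
    have : ∀ i, h i j * g i = (if i = j then 4 * x j * Q ^ 2 else 0) + 4 * Q * D j * x i ^ 2
        + 4 * Q * x j * (x i * D i) := fun i => by
      rw [hh, hg]
      split_ifs with hij
      · subst hij; ring
      · ring
    rw [Finset.sum_congr rfl fun i _ => this i, Finset.sum_add_distrib, Finset.sum_add_distrib,
      ← Finset.mul_sum, ← Finset.mul_sum]
    simp only [Finset.sum_ite_eq', Finset.mem_univ, if_true]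
    ring
  have e3 : ∀ j, (∑ i, (h i i * g j - h i j * g i)) * x j
      = (4 * d * Q ^ 2 + 8 * Q * E - 4 * Q ^ 2 - 4 * Q * E) * x j ^ 2
        - 4 * Q * N * (x j * D j) := by
    intro j
    rw [Finset.sum_sub_distrib, ← Finset.sum_mul, e1, e2, hg]
    ring
  rw [Finset.sum_congr rfl fun j _ => e3 j, Finset.sum_sub_distrib, ← Finset.mul_sum,
    ← Finset.mul_sum]
  ring

/-- On the sphere, `F · x` is `4 (d - 1) |x|² q²` for `u = (ρ² - |x|²) q`: up to a factor, the mean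
curvature of the sphere times the square of the normal derivative of `u`. -/
theorem exists_hessField_dot (ρ : ℝ) (q : MvPolynomial (Fin d) ℝ) :
    ∃ s, ∑ j, hessField (ballPoly d ρ * q) j * MvPolynomial.X j
      = 4 * ((d : MvPolynomial (Fin d) ℝ) - 1) * (∑ i, MvPolynomial.X i ^ 2) * q ^ 2
        + ballPoly d ρ * s := by
  set P := ballPoly d ρ with hP
  have hu1 : ∀ i, pderiv i (P * q) = -2 * MvPolynomial.X i * q + P * pderiv i q := fun i => by
    rw [MvPolynomial.pderiv_mul, pderiv_ballPoly]
  have hX : ∀ i j : Fin d, pderiv j (MvPolynomial.X i : MvPolynomial (Fin d) ℝ)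
      = if i = j then 1 else 0 := fun i j => by
    rw [MvPolynomial.pderiv_X, Pi.single_apply]
  have hu2 : ∀ i j, pderiv j (pderiv i (P * q)) = -2 * (if i = j then 1 else 0) * q
      - 2 * MvPolynomial.X i * pderiv j q - 2 * MvPolynomial.X j * pderiv i q
      + P * pderiv j (pderiv i q) := fun i j => by
    have h2 : pderiv j (-2 : MvPolynomial (Fin d) ℝ) = 0 := by
      rw [map_neg, show (2 : MvPolynomial (Fin d) ℝ) = MvPolynomial.C 2 from
        (map_ofNat MvPolynomial.C 2).symm, MvPolynomial.pderiv_C, neg_zero]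
    rw [hu1, map_add, MvPolynomial.pderiv_mul, MvPolynomial.pderiv_mul, MvPolynomial.pderiv_mul,
      pderiv_ballPoly, hX, h2]
    ring
  -- The computation takes place modulo the ideal generated by `ρ² - |x|²`.
  obtain ⟨A, _, π, hπ, hker⟩ : ∃ (A : Type) (_ : CommRing A) (π : MvPolynomial (Fin d) ℝ →+* A),
      π P = 0 ∧ ∀ a b, π a = π b → P ∣ a - b :=
    ⟨_, inferInstance, Ideal.Quotient.mk (Ideal.span {P}),
      Ideal.Quotient.eq_zero_iff_mem.2 (Ideal.mem_span_singleton_self P),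
      fun a b h => Ideal.mem_span_singleton.1 (Ideal.Quotient.eq.1 h)⟩
  have key := sum_hess_sub_mul_eq (fun i => π (MvPolynomial.X i)) (fun i => π (pderiv i q)) (π q)
    (g := fun i => π (pderiv i (P * q))) (h := fun i j => π (pderiv j (pderiv i (P * q))))
    (fun i => by rw [hu1]; simp only [map_add, map_mul, map_neg, map_ofNat, hπ]; ring)
    (fun i j => by
      rw [hu2]
      simp only [map_add, map_sub, map_mul, map_neg, map_ofNat, apply_ite π, map_one, map_zero, hπ]
      ring)
  obtain ⟨s, hs⟩ := hker (∑ j, hessField (P * q) j * MvPolynomial.X j)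
    (4 * ((d : MvPolynomial (Fin d) ℝ) - 1) * (∑ i, MvPolynomial.X i ^ 2) * q ^ 2) (by
      simp only [hessField, map_sum, map_mul, map_sub, map_pow, map_ofNat, map_one, map_natCast]
      exact key)
  exact ⟨s, by rw [← hs]; ring⟩

/-- The a priori estimate `‖D²u‖ ≤ ‖Δu‖` for polynomials vanishing on the sphere: the difference
of the squares is the integral of a divergence, and the boundary term has a sign because the ball
is convex. -/
theorem sum_norm_sq_hess_le (hd : 1 ≤ d) (hρ : 0 < ρ) (q : MvPolynomial (Fin d) ℝ) :
    ∑ p, ‖h2HessL _ (polyH2 d ρ (ballPoly d ρ * q)) p‖ ^ 2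
      ≤ ‖h2Laplacian (polyH2 d ρ (ballPoly d ρ * q))‖ ^ 2 := by
  set u := ballPoly d ρ * q with hu
  obtain ⟨s, hs⟩ := exists_hessField_dot ρ q
  have h := setIntegral_divergence_nonneg hρ (fun x _ => ?_) hs
  · rw [sum_pderiv_hessField, map_sub] at h
    simp only [ContinuousMap.sub_apply] at h
    rw [integral_sub (integrable_originBall ρ (evalC d _).continuous)
      (integrable_originBall ρ (evalC d _).continuous), ← inner_polyL2, map_sum] at h
    simp only [ContinuousMap.sum_apply] at h
    rw [integral_finsetSum _ fun p _ => integrable_originBall ρ (evalC d _).continuous] at h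
    simp only [← inner_polyL2, real_inner_self_eq_norm_sq] at h
    rw [h2Laplacian_polyH2]
    have h3 : ∀ p, h2HessL _ (polyH2 d ρ u) p = polyL2 d ρ (pderiv p.2 (pderiv p.1 u)) :=
      fun p => rfl
    simp only [h3]
    linarith
  · have h1 : (1 : ℝ) ≤ d := by exact_mod_cast hd
    rw [evalC_apply]
    simp only [map_mul, map_sub, map_sum, map_pow, map_ofNat, map_one, map_natCast,
      MvPolynomial.eval_X]
    exact mul_nonneg (mul_nonneg (mul_nonneg zero_le_four (by linarith))
      (Finset.sum_nonneg fun i _ => sq_nonneg _)) (sq_nonneg _)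

theorem abs_apply_le_of_mem_originBall {x : Euc d} (hx : x ∈ originBall d ρ) (i : Fin d) :
    |x i| ≤ ρ :=
  (PiLp.norm_apply_le x i).trans (mem_originBall.1 hx).le

theorem isPoincareConst_originBall (hd : 1 ≤ d) (hρ : 0 < ρ) :
    IsPoincareConst (originBall d ρ) (2 * ρ) :=
  isPoincareConst_of_abs_le ⟨0, hd⟩ (fun _ hx => abs_apply_le_of_mem_originBall hx _) hρ.le

/-- The energy identity `‖∇v‖² = -⟨Δv, v⟩` for `v ∈ H² ∩ H¹₀`. -/
theorem norm_sq_grad {Ω : Opens (Euc d)} {v : H2 Ω} (hv : h2ToH1 v ∈ H10 Ω) :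
    ‖h2Grad v‖ ^ 2 = -⟪h2Laplacian v, h2ToL2 v⟫_ℝ := by
  rw [← real_inner_self_eq_norm_sq]
  exact green v ⟨_, hv⟩

/-- On `H² ∩ H¹₀`, the gradient and the function are controlled by the Laplacian. -/
theorem norm_le_of_mem_H10 {Ω : Opens (Euc d)} {C : ℝ} (hC : IsPoincareConst Ω C) (hC0 : 0 ≤ C)
    {v : H2 Ω} (hv : h2ToH1 v ∈ H10 Ω) :
    ‖h2Grad v‖ ≤ C * ‖h2Laplacian v‖ ∧ ‖h2ToL2 v‖ ≤ C * (C * ‖h2Laplacian v‖) := by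
  have h1 : ‖h2ToL2 v‖ ≤ C * ‖h2Grad v‖ := hC ⟨_, hv⟩
  have h2 := norm_sq_grad hv
  have h3 := (abs_le.1 (abs_real_inner_le_norm (h2Laplacian v) (h2ToL2 v))).1
  have h4 : ‖h2Grad v‖ ≤ C * ‖h2Laplacian v‖ := by
    rcases (norm_nonneg (h2Grad v)).eq_or_lt with h | h
    · rw [← h]; positivity
    · refine le_of_mul_le_mul_right ?_ h
      nlinarith [mul_le_mul_of_nonneg_left h1 (norm_nonneg (h2Laplacian v))]
  exact ⟨h4, h1.trans (mul_le_mul_of_nonneg_left h4 hC0)⟩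

/-- For every polynomial `g` there is a polynomial `q` with `Δ((ρ² - |x|²) q) = g`: the map
`q ↦ Δ((ρ² - |x|²) q)` is injective and does not raise degrees. -/
theorem exists_polyLaplacian_ballPoly_mul_eq (hd : 1 ≤ d) (hρ : 0 < ρ)
    (g : MvPolynomial (Fin d) ℝ) : ∃ q, polyLaplacian d (ballPoly d ρ * q) = g := by
  let L : MvPolynomial (Fin d) ℝ →ₗ[ℝ] MvPolynomial (Fin d) ℝ :=
    polyLaplacian d ∘ₗ LinearMap.mulLeft ℝ (ballPoly d ρ)
  have hL : ∀ q, L q = polyLaplacian d (ballPoly d ρ * q) := fun _ => rfl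
  have hinj : Function.Injective L := by
    rw [injective_iff_map_eq_zero]
    intro q hq
    have h1 := (norm_le_of_mem_H10 (isPoincareConst_originBall hd hρ) (by positivity)
      (v := polyH2 d ρ (ballPoly d ρ * q)) (polyH1_ballPoly_mul_mem hρ q)).2
    rw [h2Laplacian_polyH2, ← hL, hq, map_zero, norm_zero, mul_zero, mul_zero] at h1
    have h2 : polyL2 d ρ (ballPoly d ρ * q) = 0 := norm_le_zero_iff.1 h1
    have h3 := (injective_iff_map_eq_zero _).1 (polyL2_injective hρ) _ h2
    refine (mul_eq_zero.1 h3).resolve_left fun h => ?_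
    have h4 := evalC_ballPoly ρ (0 : Euc d)
    rw [h] at h4
    simp at h4
    exact (pow_pos hρ 2).ne h4
  set V := MvPolynomial.restrictTotalDegree (Fin d) ℝ g.totalDegree
  have hV : ∀ q ∈ V, L q ∈ V := fun q hq => by
    rw [MvPolynomial.mem_restrictTotalDegree] at hq ⊢
    rw [hL, polyLaplacian_apply]
    refine MvPolynomial.totalDegree_finsetSum_le fun i _ =>
      totalDegree_pderiv_le i (totalDegree_pderiv_le i ?_)
    refine (MvPolynomial.totalDegree_mul _ _).trans ?_
    have := totalDegree_ballPoly_le (d := d) ρ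
    omega
  have hsurj : Function.Surjective (L.restrict hV) :=
    LinearMap.injective_iff_surjective.1 fun a b hab =>
      Subtype.ext (hinj (congrArg Subtype.val hab))
  obtain ⟨q, hq⟩ := hsurj ⟨g, (MvPolynomial.mem_restrictTotalDegree _ _ _).2 le_rfl⟩
  exact ⟨q, congrArg Subtype.val hq⟩

/-- A bounded operator that is bounded below on a subspace `S`, with dense image of `S`, has a
bounded right inverse with values in the closure of `S`. -/
theorem exists_right_inverse_of_dense {X Y : Type*} [NormedAddCommGroup X] [NormedSpace ℝ X]
    [CompleteSpace X] [NormedAddCommGroup Y] [NormedSpace ℝ Y] [CompleteSpace Y] (L : X →L[ℝ] Y)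
    (S : Submodule ℝ X) {C : ℝ} (hC : 0 ≤ C) (hS : ∀ v ∈ S, ‖v‖ ≤ C * ‖L v‖)
    (hdense : Dense (L '' S)) :
    ∃ K : Y →L[ℝ] X, ∀ g, K g ∈ S.topologicalClosure ∧ L (K g) = g := by
  set Z := S.topologicalClosure
  have hZ : IsClosed (Z : Set X) := Submodule.isClosed_topologicalClosure _
  have : CompleteSpace Z := hZ.completeSpace_coe
  let M : Z →L[ℝ] Y := L.comp Z.subtypeL
  have hbound : ∀ v : Z, ‖v‖ ≤ C * ‖M v‖ := fun v =>
    closure_minimal (t := {v : X | ‖v‖ ≤ C * ‖L v‖}) hS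
      (isClosed_le continuous_norm (continuous_const.mul L.continuous.norm)) v.2
  have hanti := M.antilipschitz_of_bound (K := ⟨C, hC⟩) hbound
  have hsurj : M.range = ⊤ := by
    refine LinearMap.range_eq_top.2 (range_eq_univ.1 ?_)
    refine (hanti.isClosed_range M.uniformContinuous).closure_eq.symm.trans ?_
    refine Dense.closure_eq (hdense.mono ?_)
    rintro _ ⟨v, hv, rfl⟩
    exact ⟨⟨v, Submodule.le_topologicalClosure _ hv⟩, rfl⟩
  let e := ContinuousLinearEquiv.ofBijective M (LinearMap.ker_eq_bot.2 hanti.injective) hsurj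
  exact ⟨Z.subtypeL.comp (e.symm : Y →L[ℝ] Z), fun g => ⟨(e.symm g).2, e.apply_symm_apply g⟩⟩

/-- The a priori estimate in `H²` for polynomials that vanish on the sphere. -/
theorem norm_polyH2_le (hd : 1 ≤ d) (hρ : 0 < ρ) (q : MvPolynomial (Fin d) ℝ) :
    ‖polyH2 d ρ (ballPoly d ρ * q)‖ ≤ ((2 * ρ) ^ 2 + 2 * ρ + 1)
      * ‖h2Laplacian (polyH2 d ρ (ballPoly d ρ * q))‖ := by
  set v := polyH2 d ρ (ballPoly d ρ * q)
  set C : ℝ := 2 * ρ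
  have hC0 : 0 ≤ C := by positivity
  obtain ⟨h1, h2⟩ := norm_le_of_mem_H10 (isPoincareConst_originBall hd hρ) hC0
    (v := v) (polyH1_ballPoly_mul_mem hρ q)
  have h3 : ∑ p, ‖v.1.snd p‖ ^ 2 ≤ ‖h2Laplacian v‖ ^ 2 := sum_norm_sq_hess_le hd hρ q
  have h4 : ‖v‖ ^ 2 = ‖h2ToL2 v‖ ^ 2 + ‖h2Grad v‖ ^ 2 + ∑ p, ‖v.1.snd p‖ ^ 2 := by
    rw [norm_sq_h2, norm_sq_h1]; rfl
  have h5 := pow_le_pow_left₀ (norm_nonneg _) h2 2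
  have h6 := pow_le_pow_left₀ (norm_nonneg _) h1 2
  have h7 : 0 ≤ (2 * C ^ 3 + 2 * C ^ 2 + 2 * C) * ‖h2Laplacian v‖ ^ 2 := by positivity
  refine (sq_le_sq₀ (norm_nonneg _) (by positivity)).1 ?_
  refine h4.trans_le ?_
  nlinarith

/-- **Elliptic regularity**: on a ball, the Dirichlet problem `Δv = g`, `v ∈ H¹₀`, has a solution
in `H²` that depends continuously on `g ∈ L²`. -/
theorem exists_solution_operator (hd : 1 ≤ d) (hρ : 0 < ρ) :
    ∃ K : L2 (originBall d ρ) →L[ℝ] H2 (originBall d ρ),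
      ∀ g, h2ToH1 (K g) ∈ H10 (originBall d ρ) ∧ h2Laplacian (K g) = g := by
  set S := LinearMap.range (polyH2 d ρ ∘ₗ LinearMap.mulLeft ℝ (ballPoly d ρ)) with hS
  have hbound : ∀ v ∈ S, ‖v‖ ≤ ((2 * ρ) ^ 2 + 2 * ρ + 1) * ‖h2LaplacianL (originBall d ρ) v‖ := by
    rintro _ ⟨q, rfl⟩
    rw [h2LaplacianL_apply]
    exact norm_polyH2_le hd hρ q
  have hdense : Dense (h2LaplacianL (originBall d ρ) '' S) := by
    refine (denseRange_polyL2 d ρ).mono ?_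
    rintro _ ⟨g, rfl⟩
    obtain ⟨q, hq⟩ := exists_polyLaplacian_ballPoly_mul_eq hd hρ g
    refine ⟨_, ⟨q, rfl⟩, ?_⟩
    rw [h2LaplacianL_apply, ← hq, ← h2Laplacian_polyH2]
    rfl
  obtain ⟨K, hK⟩ := exists_right_inverse_of_dense (h2LaplacianL (originBall d ρ)) S
    (by positivity) hbound hdense
  refine ⟨K, fun g => ⟨?_, (h2LaplacianL_apply _).symm.trans (hK g).2⟩⟩
  refine closure_minimal (t := h2ToH1L (originBall d ρ) ⁻¹' (H10 (originBall d ρ))) ?_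
    ((Submodule.isClosed_topologicalClosure _).preimage (h2ToH1L _).continuous) (hK g).1
  rintro _ ⟨q, rfl⟩
  exact polyH1_ballPoly_mul_mem hρ q

end regularity
/-! ### The wave equation as a first-order system in the energy space -/

section system

variable {G H : Type*} [NormedAddCommGroup G] [InnerProductSpace ℝ G]
  [NormedAddCommGroup H] [InnerProductSpace ℝ H]

/-- The inverse of the wave operator on the energy space: `(a, b) ↦ (A b, ι a)`. Here `G` stands
for gradients of `H¹₀` functions, `ι` recovers a function from its gradient and `A = ∇ Δ⁻¹`. -/
noncomputable def waveInverse (A : H →L[ℝ] G) (ι : G →L[ℝ] H) :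
    WithLp 2 (G × H) →L[ℝ] WithLp 2 (G × H) :=
  (WithLp.prodContinuousLinearEquiv 2 ℝ G H).symm.toContinuousLinearMap.comp
    ((A.comp (WithLp.sndL 2 ℝ G H)).prod (ι.comp (WithLp.fstL 2 ℝ G H)))

theorem waveInverse_apply (A : H →L[ℝ] G) (ι : G →L[ℝ] H) (x : WithLp 2 (G × H)) :
    waveInverse A ι x = WithLp.toLp 2 (A x.snd, ι x.fst) := rfl

variable [CompleteSpace G] [CompleteSpace H]

theorem adjoint_waveInverse {A : H →L[ℝ] G} {ι : G →L[ℝ] H}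
    (h : ∀ b a, ⟪A b, a⟫_ℝ = -⟪b, ι a⟫_ℝ) :
    ContinuousLinearMap.adjoint (waveInverse A ι) = -waveInverse A ι := by
  symm
  rw [ContinuousLinearMap.eq_adjoint_iff]
  intro x y
  have h1 := h x.snd y.fst
  have h2 := h y.snd x.fst
  rw [real_inner_comm, real_inner_comm (ι x.fst)] at h2
  rw [neg_apply, inner_neg_left, waveInverse_apply, waveInverse_apply, WithLp.prod_inner_apply,
    WithLp.prod_inner_apply]
  change -(⟪A x.snd, y.fst⟫_ℝ + ⟪ι x.fst, y.snd⟫_ℝ) = ⟪x.fst, A y.snd⟫_ℝ + ⟪x.snd, ι y.fst⟫_ℝ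
  linarith

/-- Solution of the system `(A W₂)' = W₁`, `(ι W₁)' = W₂ + ι F` with zero initial values, with the
energy estimates at the levels of `W` and of `J W = (A W₂, ι W₁)`. -/
theorem exists_wave_system {A : H →L[ℝ] G} {ι : G →L[ℝ] H}
    (h : ∀ b a, ⟪A b, a⟫_ℝ = -⟪b, ι a⟫_ℝ) (hA : Function.Injective A) (hι : Function.Injective ι)
    {F : ℝ → G} (hF : Continuous F) :
    ∃ (W₁ : ℝ → G) (W₂ : ℝ → H), Continuous W₁ ∧ Continuous W₂ ∧ W₁ 0 = 0 ∧ W₂ 0 = 0 ∧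
      (∀ t, HasDerivAt (fun s => A (W₂ s)) (W₁ t) t) ∧
      (∀ t, HasDerivAt (fun s => ι (W₁ s)) (W₂ t + ι (F t)) t) ∧
      (∀ t ≥ 0, ‖W₂ t‖ ≤ ∫ τ in (0 : ℝ)..t, ‖F τ‖) ∧
      ∀ t ≥ 0, ‖A (W₂ t)‖ ≤ ∫ τ in (0 : ℝ)..t, ‖ι (F τ)‖ := by
  have hinj : Function.Injective (waveInverse A ι) := by
    intro x y hxy
    rw [waveInverse_apply, waveInverse_apply] at hxy
    have h1 := WithLp.toLp_injective 2 hxy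
    exact WithLp.ofLp_injective 2
      (Prod.ext (hι (congrArg Prod.snd h1)) (hA (congrArg Prod.fst h1)))
  have hG : Continuous fun t => WithLp.toLp 2 (F t, (0 : H)) :=
    (WithLp.prod_continuous_toLp 2 G H).comp (hF.prodMk continuous_const)
  obtain ⟨W, hW, hW0, hderiv, hb, hb'⟩ := exists_duhamel (adjoint_waveInverse h) hinj hG
  refine ⟨fun t => (W t).fst, fun t => (W t).snd, (WithLp.fstL 2 ℝ G H).continuous.comp hW,
    (WithLp.sndL 2 ℝ G H).continuous.comp hW, congrArg WithLp.fst hW0,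
    congrArg WithLp.snd hW0,
    fun t => ?_, fun t => ?_, fun t ht => ?_, fun t ht => ?_⟩
  · have h1 := (WithLp.fstL 2 ℝ G H).hasFDerivAt.comp_hasDerivAt t (hderiv t)
    refine HasDerivAt.congr_deriv h1 ?_
    change (W t).fst + A 0 = _
    rw [map_zero, add_zero]
  · exact (WithLp.sndL 2 ℝ G H).hasFDerivAt.comp_hasDerivAt t (hderiv t)
  · refine (WithLp.norm_snd_le (p := 2) _ (W t)).trans ((hb t ht).trans_eq ?_)
    simp only [WithLp.norm_toLp_fst]
  · have h1 := WithLp.norm_fst_le (p := 2) _ (waveInverse A ι (W t))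
    refine h1.trans ((hb' t ht).trans_eq ?_)
    congr 1; ext τ
    rw [waveInverse_apply]
    change ‖WithLp.toLp 2 (A 0, ι (F τ))‖ = _
    rw [map_zero, WithLp.norm_toLp_snd]

/-- The same system with `G` replaced by a space `V` that carries the norm `‖∇ ·‖` only up to
equivalence: `V` is identified with the range of `D = ∇`, which is complete. -/
theorem exists_wave_system_of_gradient {V E : Type*} [NormedAddCommGroup V] [NormedSpace ℝ V]
    [CompleteSpace V] [NormedAddCommGroup E] [InnerProductSpace ℝ E] [CompleteSpace E]
    (D : V →L[ℝ] E) {c : ℝ} (hc : 0 ≤ c) (hD : ∀ v, ‖v‖ ≤ c * ‖D v‖)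
    {B : H →L[ℝ] V} {ι : V →L[ℝ] H} (h : ∀ b v, ⟪D (B b), D v⟫_ℝ = -⟪b, ι v⟫_ℝ)
    (hB : Function.Injective B) (hι : Function.Injective ι) {F : ℝ → V} (hF : Continuous F) :
    ∃ (W₁ : ℝ → V) (W₂ : ℝ → H), Continuous W₁ ∧ Continuous W₂ ∧ W₁ 0 = 0 ∧ W₂ 0 = 0 ∧
      (∀ t, HasDerivAt (fun s => B (W₂ s)) (W₁ t) t) ∧
      (∀ t, HasDerivAt (fun s => ι (W₁ s)) (W₂ t + ι (F t)) t) ∧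
      (∀ t ≥ 0, ‖W₂ t‖ ≤ ∫ τ in (0 : ℝ)..t, ‖D (F τ)‖) ∧
      ∀ t ≥ 0, ‖D (B (W₂ t))‖ ≤ ∫ τ in (0 : ℝ)..t, ‖ι (F τ)‖ := by
  have hanti := D.antilipschitz_of_bound (K := ⟨c, hc⟩) hD
  have hclo : IsClosed (range D) := hanti.isClosed_range D.uniformContinuous
  have : CompleteSpace D.range := hclo.completeSpace_coe
  let e : V ≃L[ℝ] D.range := D.equivRange hanti.injective hclo
  let A : H →L[ℝ] D.range := (e : V →L[ℝ] D.range).comp B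
  let κ : D.range →L[ℝ] H := ι.comp (e.symm : D.range →L[ℝ] V)
  have hκ : ∀ v, κ (e v) = ι v := fun v => congrArg ι (e.symm_apply_apply v)
  have hskew : ∀ b a, ⟪A b, a⟫_ℝ = -⟪b, κ a⟫_ℝ := fun b a => by
    obtain ⟨v, rfl⟩ := e.surjective a
    rw [hκ]
    exact h b v
  obtain ⟨W₁, W₂, h1, h2, h3, h4, h5, h6, h7, h8⟩ := exists_wave_system hskew
    (e.injective.comp hB) (hι.comp e.symm.injective) (e.continuous.comp hF)
  refine ⟨fun t => e.symm (W₁ t), W₂, e.symm.continuous.comp h1, h2,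
    by simp only [h3, map_zero], h4, fun t => ?_, fun t => ?_, h7, fun t ht => ?_⟩
  · have h9 := (e.symm : D.range →L[ℝ] V).hasFDerivAt.comp_hasDerivAt t (h5 t)
    refine HasDerivAt.congr_of_eventuallyEq h9 (Eventually.of_forall fun s => ?_)
    exact (e.symm_apply_apply (B (W₂ s))).symm
  · have h9 := h6 t
    simp only [Function.comp_apply, hκ] at h9
    exact h9
  · refine (h8 t ht).trans_eq ?_
    simp only [Function.comp_apply, hκ]

theorem contDiff_two_of_hasDerivAt {X : Type*} [NormedAddCommGroup X] [NormedSpace ℝ X]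
    {z z' z'' : ℝ → X} (h : ∀ t, HasDerivAt z (z' t) t) (h' : ∀ t, HasDerivAt z' (z'' t) t)
    (hc : Continuous z'') : ContDiff ℝ 2 z := by
  have e : deriv z = z' := funext fun t => (h t).deriv
  have e' : deriv z' = z'' := funext fun t => (h' t).deriv
  rw [show (2 : WithTop ℕ∞) = 1 + 1 from rfl, contDiff_succ_iff_deriv, e,
    contDiff_one_iff_deriv, e']
  exact ⟨fun t => (h t).differentiableAt, by simp, fun t => (h' t).differentiableAt, hc⟩

/-- The wave equation `y'' = Δ y + f` for `y = ι w`, `w = B W₂`, with `B = Δ⁻¹`. -/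
theorem exists_wave_of_gradient {V E : Type*} [NormedAddCommGroup V] [NormedSpace ℝ V]
    [CompleteSpace V] [NormedAddCommGroup E] [InnerProductSpace ℝ E] [CompleteSpace E]
    (D : V →L[ℝ] E) {c : ℝ} (hc : 0 ≤ c) (hD : ∀ v, ‖v‖ ≤ c * ‖D v‖)
    {B : H →L[ℝ] V} {ι : V →L[ℝ] H} (h : ∀ b v, ⟪D (B b), D v⟫_ℝ = -⟪b, ι v⟫_ℝ)
    (hB : Function.Injective B) (hι : Function.Injective ι) {f : ℝ → V}
    (hf : ContinuousOn f (Ici 0)) :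
    ∃ W : ℝ → H, Continuous W ∧ W 0 = 0 ∧ ContDiff ℝ 1 (fun t => B (W t)) ∧
      ContDiff ℝ 2 (fun t => ι (B (W t))) ∧
      (∀ t ≥ 0, derivWithin (derivWithin (fun t => ι (B (W t))) (Ici 0)) (Ici 0) t
        = W t + ι (f t)) ∧
      derivWithin (fun t => ι (B (W t))) (Ici 0) 0 = 0 ∧
      (∀ t ≥ 0, ‖D (B (W t))‖ ≤ ∫ τ in (0 : ℝ)..t, ‖ι (f τ)‖) ∧
      ∀ t ≥ 0, ‖W t‖ ≤ ∫ τ in (0 : ℝ)..t, ‖D (f τ)‖ := by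
  -- `f` is extended continuously to negative times.
  have hF : Continuous fun t => f (max t 0) :=
    hf.comp_continuous (continuous_id.max continuous_const) fun t => le_max_right t 0
  have hFf : ∀ t ≥ 0, f (max t 0) = f t := fun t ht => by rw [max_eq_left ht]
  obtain ⟨W₁, W₂, h1, h2, h3, h4, h5, h6, h7, h8⟩ :=
    exists_wave_system_of_gradient D hc hD h hB hι hF
  have hud := uniqueDiffOn_Ici (0 : ℝ)
  have hz : ∀ t, HasDerivAt (fun t => ι (B (W₂ t))) (ι (W₁ t)) t := fun t =>
    ι.hasFDerivAt.comp_hasDerivAt t (h5 t)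
  have hz1 : ∀ t ≥ 0, derivWithin (fun t => ι (B (W₂ t))) (Ici 0) t = ι (W₁ t) :=
    fun t ht => (hz t).hasDerivWithinAt.derivWithin (hud t ht)
  refine ⟨W₂, h2, h4, ?_, contDiff_two_of_hasDerivAt hz h6 (h2.add (ι.continuous.comp hF)),
    fun t ht => ?_, ?_, fun t ht => ?_, fun t ht => ?_⟩
  · refine contDiff_one_iff_deriv.2 ⟨fun t => (h5 t).differentiableAt, ?_⟩
    rw [funext fun t => (h5 t).deriv]
    exact h1
  · rw [derivWithin_congr (s := Ici 0) hz1 (hz1 t ht),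
      (h6 t).hasDerivWithinAt.derivWithin (hud t ht), hFf t ht]
  · rw [hz1 0 le_rfl, h3, map_zero]
  · refine (h8 t ht).trans_eq (intervalIntegral.integral_congr fun τ hτ => ?_)
    rw [uIcc_of_le ht] at hτ
    simp only [hFf τ hτ.1]
  · refine (h7 t ht).trans_eq (intervalIntegral.integral_congr fun τ hτ => ?_)
    rw [uIcc_of_le ht] at hτ
    simp only [hFf τ hτ.1]

end system

section energy

variable {V H E : Type*} [NormedAddCommGroup V] [NormedSpace ℝ V] [NormedAddCommGroup H]
  [InnerProductSpace ℝ H] [NormedAddCommGroup E] [InnerProductSpace ℝ E]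

/-- A homogeneous wave equation `(ι w)'' = L` with `⟪∇w, ∇w'⟫ = -⟪L, ι w'⟫` and zero initial values
has only the zero solution, because the energy `‖∇w‖² + ‖ι w'‖²` is constant. -/
theorem eq_zero_of_energy (D : V →L[ℝ] E) (ι : V →L[ℝ] H) {w w' : ℝ → V} {L : ℝ → H}
    (hw : ∀ s ≥ 0, HasDerivWithinAt w (w' s) (Ici 0) s)
    (hw' : ∀ s ≥ 0, HasDerivWithinAt (fun s => ι (w' s)) (L s) (Ici 0) s)
    (hL : ∀ s ≥ 0, ⟪D (w s), D (w' s)⟫_ℝ = -⟪L s, ι (w' s)⟫_ℝ)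
    (h0 : w 0 = 0) (h0' : ι (w' 0) = 0) {t : ℝ} (ht : 0 ≤ t) : ι (w t) = 0 := by
  have hE : ∀ s ≥ 0,
      HasDerivWithinAt (fun s => ‖D (w s)‖ ^ 2 + ‖ι (w' s)‖ ^ 2) 0 (Ici 0) s := by
    intro s hs
    have h1 := (D.hasFDerivAt.comp_hasDerivWithinAt s (hw s hs)).norm_sq
    have h2 := (hw' s hs).norm_sq
    refine (h1.add h2).congr_deriv ?_
    simp only [Function.comp_apply]
    rw [hL s hs, real_inner_comm]
    ring
  have hzero : ∀ s ≥ 0, ι (w' s) = 0 := fun s hs => by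
    have h1 := (convex_Ici (0 : ℝ)).norm_image_sub_le_of_norm_hasDerivWithin_le (C := 0)
      (fun r hr => hE r hr) (fun r _ => norm_zero.le) (mem_Ici.2 le_rfl) (mem_Ici.2 hs)
    rw [zero_mul, norm_le_zero_iff, sub_eq_zero, h0, h0', map_zero, norm_zero, norm_zero] at h1
    have h2 := sq_nonneg ‖D (w s)‖
    have h3 : ‖ι (w' s)‖ ^ 2 ≤ 0 := by linarith
    exact norm_eq_zero.1 (pow_eq_zero_iff two_ne_zero |>.1 (le_antisymm h3 (sq_nonneg _)))
  have hconst := (convex_Ici (0 : ℝ)).norm_image_sub_le_of_norm_hasDerivWithin_le (C := 0)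
    (fun r hr => ι.hasFDerivAt.comp_hasDerivWithinAt r (hw r hr))
    (fun r hr => by rw [hzero r hr, norm_zero]) (mem_Ici.2 le_rfl) (mem_Ici.2 ht)
  rw [zero_mul, norm_le_zero_iff, sub_eq_zero] at hconst
  rw [Function.comp_apply, Function.comp_apply, h0, map_zero] at hconst
  exact hconst

/-- Two solutions of the same inhomogeneous equation agree. -/
theorem eq_of_energy (D : V →L[ℝ] E) (ι : V →L[ℝ] H) {w₁ w₁' w₂ w₂' : ℝ → V} {L₁ L₂ F : ℝ → H}
    (h₁ : ∀ s ≥ 0, HasDerivWithinAt w₁ (w₁' s) (Ici 0) s)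
    (h₂ : ∀ s ≥ 0, HasDerivWithinAt w₂ (w₂' s) (Ici 0) s)
    (h₁' : ∀ s ≥ 0, HasDerivWithinAt (fun s => ι (w₁' s)) (L₁ s + F s) (Ici 0) s)
    (h₂' : ∀ s ≥ 0, HasDerivWithinAt (fun s => ι (w₂' s)) (L₂ s + F s) (Ici 0) s)
    (hL : ∀ s ≥ 0, ⟪D (w₁ s - w₂ s), D (w₁' s - w₂' s)⟫_ℝ = -⟪L₁ s - L₂ s, ι (w₁' s - w₂' s)⟫_ℝ)
    (h₁0 : w₁ 0 = 0) (h₂0 : w₂ 0 = 0) (h₁0' : ι (w₁' 0) = 0) (h₂0' : ι (w₂' 0) = 0)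
    {t : ℝ} (ht : 0 ≤ t) : ι (w₁ t - w₂ t) = 0 := by
  refine eq_zero_of_energy D ι (w := fun s => w₁ s - w₂ s) (w' := fun s => w₁' s - w₂' s)
    (fun s hs => (h₁ s hs).sub (h₂ s hs)) (fun s hs => ?_) hL ?_ ?_ ht
  · have h3 := (h₁' s hs).sub (h₂' s hs)
    rw [add_sub_add_right_eq_sub] at h3
    simp only [map_sub]
    exact h3
  · rw [h₁0, h₂0, sub_zero]
  · rw [map_sub, h₁0', h₂0', sub_zero]

theorem hasDerivWithinAt_of_contDiffOn_comp (ι : V →L[ℝ] H) {w : ℝ → V} {y : ℝ → H}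
    (hw : ContDiffOn ℝ 1 w (Ici 0)) (hy : ContDiffOn ℝ 2 y (Ici 0)) (hwy : ∀ s ≥ 0, ι (w s) = y s)
    {s : ℝ} (hs : 0 ≤ s) :
    HasDerivWithinAt w (derivWithin w (Ici 0) s) (Ici 0) s ∧
    ι (derivWithin w (Ici 0) s) = derivWithin y (Ici 0) s ∧
    HasDerivWithinAt (fun s => ι (derivWithin w (Ici 0) s))
      (derivWithin (derivWithin y (Ici 0)) (Ici 0) s) (Ici 0) s := by
  have hud := uniqueDiffOn_Ici (0 : ℝ)
  have h1 : ∀ r ≥ 0, HasDerivWithinAt w (derivWithin w (Ici 0) r) (Ici 0) r := fun r hr =>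
    (hw.differentiableOn one_ne_zero r hr).hasDerivWithinAt
  have h2 : ∀ r ≥ 0, ι (derivWithin w (Ici 0) r) = derivWithin y (Ici 0) r := fun r hr => by
    have h3 := ι.hasFDerivAt.comp_hasDerivWithinAt r (h1 r hr)
    exact ((h3.congr (fun q hq => (hwy q hq).symm) (hwy r hr).symm).derivWithin (hud r hr)).symm
  refine ⟨h1 s hs, h2 s hs, ?_⟩
  have h4 := ((hy.derivWithin hud (m := 1) (by norm_num)).differentiableOn
    one_ne_zero s hs).hasDerivWithinAt
  exact h4.congr h2 (h2 s hs)

end energy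

/-! ### Strong solutions -/

section solutions

variable {d : ℕ} {Ω : Opens (Euc d)}

/-- A strong solution as a curve `w` in `H¹₀` whose derivative is differentiable in `L²`. -/
theorem IsStrongSolution.exists_H10 {f : ℝ → H10 Ω} {u : ℝ → H2 Ω} (hu : IsStrongSolution Ω f u) :
    ∃ w w' : ℝ → H10 Ω, (∀ s ≥ 0, (w s : H1 Ω) = h2ToH1 (u s)) ∧
      (∀ s ≥ 0, HasDerivWithinAt w (w' s) (Ici 0) s) ∧
      (∀ s ≥ 0, HasDerivWithinAt (fun s => h10ToL2L Ω (w' s))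
        (h2LaplacianL Ω (u s) + h10ToL2L Ω (f s)) (Ici 0) s) ∧
      w 0 = 0 ∧ h10ToL2L Ω (w' 0) = 0 := by
  obtain ⟨w, hw, hwu⟩ := hu.contDiff_H10
  have hwy : ∀ s ≥ 0, h10ToL2L Ω (w s) = h2ToL2 (u s) := fun s hs => congrArg h1ToL2 (hwu s hs)
  have key := fun (s : ℝ) (hs : 0 ≤ s) =>
    hasDerivWithinAt_of_contDiffOn_comp (h10ToL2L Ω) hw hu.contDiff_L2 hwy hs
  refine ⟨w, derivWithin w (Ici 0), hwu, fun s hs => (key s hs).1, fun s hs => ?_, ?_, ?_⟩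
  · have h1 := (key s hs).2.2
    rw [hu.wave s hs] at h1
    rw [h2LaplacianL_apply]
    exact h1
  · apply h10ToL2_injective (Ω := Ω)
    have h1 : h10ToL2L Ω (w 0) = 0 := (hwy 0 le_rfl).trans hu.init
    exact h1.trans (map_zero (h10ToL2L Ω)).symm
  · exact (key 0 le_rfl).2.1.trans hu.init_deriv

/-- **Uniqueness** of strong solutions, by conservation of the energy `‖∇w‖² + ‖ẇ‖²` of the
difference `w` of two solutions. -/
theorem IsStrongSolution.unique {f : ℝ → H10 Ω} {u v : ℝ → H2 Ω} (hu : IsStrongSolution Ω f u)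
    (hv : IsStrongSolution Ω f v) {t : ℝ} (ht : 0 ≤ t) : v t = u t := by
  obtain ⟨wu, wu', hu1, hu2, hu3, hu4, hu5⟩ := hu.exists_H10
  obtain ⟨wv, wv', hv1, hv2, hv3, hv4, hv5⟩ := hv.exists_H10
  have hval : ∀ s ≥ 0, ((wu s - wv s : H10 Ω) : H1 Ω) = h2ToH1L Ω (u s - v s) := fun s hs => by
    rw [map_sub]
    exact congrArg₂ (fun a b : H1 Ω => a - b) (hu1 s hs) (hv1 s hs)
  have hL : ∀ s ≥ 0, ⟪h10GradL Ω (wu s - wv s), h10GradL Ω (wu' s - wv' s)⟫_ℝ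
      = -⟪h2LaplacianL Ω (u s) - h2LaplacianL Ω (v s), h10ToL2L Ω (wu' s - wv' s)⟫_ℝ := by
    intro s hs
    have h3 := green (u s - v s) (wu' s - wv' s)
    have h4 : h10GradL Ω (wu s - wv s) = h2Grad (u s - v s) := congrArg h1Grad (hval s hs)
    have h5 : h2LaplacianL Ω (u s) - h2LaplacianL Ω (v s) = h2Laplacian (u s - v s) := by
      rw [← map_sub, h2LaplacianL_apply]
    rw [h4, h5]
    exact h3
  have hz : h10ToL2L Ω (wu t - wv t) = 0 :=
    eq_of_energy (V := H10 Ω) (H := L2 Ω) (E := L2Pow (Fin d) Ω) (h10GradL Ω) (h10ToL2L Ω)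
      hu2 hv2 hu3 hv3 hL hu4 hv4 hu5 hv5 ht
  have h1 : wu t - wv t = 0 := h10ToL2_injective (hz.trans (map_zero (h10ToL2L Ω)).symm)
  have h2 : h2ToH1L Ω (u t - v t) = 0 := by rw [← hval t ht, h1]; rfl
  have h3 : u t - v t = 0 := h2ToH1_injective (h2.trans (map_zero (h2ToH1L Ω)).symm)
  exact (sub_eq_zero.1 h3).symm

/-- **Existence** of a strong solution with the energy estimates on a domain with a Poincaré
inequality on which the Dirichlet problem has full `H²` regularity. -/
theorem exists_isStrongSolution {C : ℝ} (hC : IsPoincareConst Ω C) (hC0 : 0 ≤ C)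
    (K : L2 Ω →L[ℝ] H2 Ω) (hK : ∀ g, h2ToH1 (K g) ∈ H10 Ω ∧ h2Laplacian (K g) = g)
    {f : ℝ → H10 Ω} (hf : ContinuousOn f (Ici 0)) :
    ∃ u : ℝ → H2 Ω, IsStrongSolution Ω f u ∧ ∀ t ≥ 0, h2ToH1 (u t) ∈ H10 Ω ∧
      ‖h2Grad (u t)‖ ≤ ∫ τ in (0 : ℝ)..t, ‖h10ToL2 (f τ)‖ ∧
      ‖h2Laplacian (u t)‖ ≤ ∫ τ in (0 : ℝ)..t, ‖h10Grad (f τ)‖ := by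
  let B : L2 Ω →L[ℝ] H10 Ω := ((h2ToH1L Ω).comp K).codRestrict (H10 Ω) fun g => (hK g).1
  have hB : ∀ g, ((B g : H10 Ω) : H1 Ω) = h2ToH1 (K g) := fun _ => rfl
  have hgreen : ∀ g v, ⟪h10GradL Ω (B g), h10GradL Ω v⟫_ℝ = -⟪g, h10ToL2L Ω v⟫_ℝ := fun g v => by
    have h1 := green (K g) v
    rw [(hK g).2] at h1
    exact h1
  have hBinj : Function.Injective B := by
    rw [injective_iff_map_eq_zero]
    intro g hg
    have h1 : h2ToH1 (K g) = 0 := by rw [← hB, hg]; rfl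
    have h2 : K g = 0 := h2ToH1_injective h1
    rw [← (hK g).2, h2, ← h2LaplacianL_apply, map_zero]
  have hD : ∀ v : H10 Ω, ‖v‖ ≤ (C + 1) * ‖h10GradL Ω v‖ := fun v => by
    have h1 : ‖h10ToL2 v‖ ≤ C * ‖h10GradL Ω v‖ := hC v
    have h2 : ‖v‖ ^ 2 = ‖h10ToL2 v‖ ^ 2 + ‖h10GradL Ω v‖ ^ 2 := norm_sq_h1 (v : H1 Ω)
    refine (sq_le_sq₀ (norm_nonneg _) (by positivity)).1 ?_
    have h3 := pow_le_pow_left₀ (norm_nonneg _) h1 2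
    have h4 : 0 ≤ 2 * C * ‖h10GradL Ω v‖ ^ 2 := by positivity
    refine h2.trans_le ?_
    nlinarith
  obtain ⟨W, h1, h2, h3, h4, h5, h6, h7, h8⟩ := exists_wave_of_gradient (V := H10 Ω) (H := L2 Ω)
    (E := L2Pow (Fin d) Ω) (h10GradL Ω) (by positivity) hD hgreen hBinj h10ToL2_injective hf
  have hL : ∀ g, h2Laplacian (K g) = g := fun g => (hK g).2
  refine ⟨fun t => K (W t), ⟨h4.contDiffOn, ⟨fun t => B (W t), h3.contDiffOn, fun t _ => hB _⟩,
    (K.continuous.comp h1).continuousOn, fun t ht => ?_, ?_, h6⟩,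
    fun t ht => ⟨(hK _).1, h7 t ht, ?_⟩⟩
  · rw [hL]
    exact h5 t ht
  · change h10ToL2L Ω (B (W 0)) = 0
    rw [h2, map_zero, map_zero]
  · rw [hL]
    exact h8 t ht

end solutions
end DirichletWave

open DirichletWave
theorem proposition8p1 (d : ℕ) (hd : 1 ≤ d) (R T : ℝ) (hR : 0 < R) (hT : 0 ≤ T) :
    (∃ C : ℝ, IsPoincareConst (originBall d (R + T)) C) ∧
    ∀ f : ℝ → H10 (originBall d (R + T)), ContinuousOn f (Set.Ici 0) →
      ∃ u : ℝ → H2 (originBall d (R + T)),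
        IsStrongSolution (originBall d (R + T)) f u ∧
        (∀ v : ℝ → H2 (originBall d (R + T)),
          IsStrongSolution (originBall d (R + T)) f v → ∀ t ≥ 0, v t = u t) ∧
        ∀ t ≥ 0,
          (∀ C : ℝ, IsPoincareConst (originBall d (R + T)) C →
            ‖h2ToL2 (u t)‖ ≤ C * ∫ τ in (0 : ℝ)..t, ‖h10ToL2 (f τ)‖) ∧
          ‖h2Grad (u t)‖ ≤ ∫ τ in (0 : ℝ)..t, ‖h10ToL2 (f τ)‖ ∧
          ‖h2Laplacian (u t)‖ ≤ ∫ τ in (0 : ℝ)..t, ‖h10Grad (f τ)‖ := by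
  have hρ : 0 < R + T := by linarith
  have hP := isPoincareConst_originBall hd hρ
  obtain ⟨K, hK⟩ := exists_solution_operator hd hρ
  refine ⟨⟨_, hP⟩, fun f hf => ?_⟩
  obtain ⟨u, hu, hest⟩ := exists_isStrongSolution hP (by positivity) K hK hf
  refine ⟨u, hu, fun v hv t ht => hu.unique hv ht, fun t ht => ⟨fun C hC => ?_, (hest t ht).2⟩⟩
  obtain ⟨hmem, hgrad, -⟩ := hest t ht
  have h1 : ‖h2ToL2 (u t)‖ ≤ C * ‖h2Grad (u t)‖ := hC ⟨_, hmem⟩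
  rcases le_or_gt 0 C with hC0 | hC0
  · exact h1.trans (mul_le_mul_of_nonneg_left hgrad hC0)
  · -- A negative constant forces `H¹₀` to be trivial, so that both sides vanish.
    have h2 : ∀ w : H10 (originBall d (R + T)), ‖h10ToL2 w‖ = 0 := fun w =>
      le_antisymm ((hC w).trans (mul_nonpos_of_nonpos_of_nonneg hC0.le (norm_nonneg _)))
        (norm_nonneg _)
    simp only [h2, intervalIntegral.integral_zero, mul_zero]
    exact h1.trans (mul_nonpos_of_nonpos_of_nonneg hC0.le (norm_nonneg _))
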